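/- **Setting.** Let $W=W_{\mathrm{aff}}\rtimes\Omega$ be an extended Coxeter group: $(W_{\mathrm{aff}},S)$ is a Coxeter group and the conjugation action of $\Omega$ on $W_{\mathrm{aff}}$ preserves $S$; write $u(s)=usu^{-1}$ for $u\in\Omega$, $s\in S$. The length of $W_{\mathrm{aff}}$ is extended to $W$ by $\ell(vu)=\ell(v)$ ($v\in W_{\mathrm{aff}}$, $u\in\Omega$), and $m(s,t)$ is the order of $st$. Let $W^{(1)}$ be a pro-$p$ Coxeter group over $W$: a group with a surjection $\pi:W^{(1)}\to W$ whose kernel $T$ is abelian, and with lifts $n_s\in\pi^{-1}(s)$, $s\in S$, such that $n_sn_tn_s\cdots=n_tn_sn_t\cdots$ ($m(s,t)$ factors on both sides) whenever $m(s,t)<\infty$. Put $\ell(w)=\ell(\pi(w))$ for $w\in W^{(1)}$ and $\Omega^{(1)}=\pi^{-1}(\Omega)$. Let $R$ be a commutative ring, and let $a_s\in R$, $b_s\in R[T]$ ($s\in S$) be parameters such that $s\pi(w)=\pi(w)t$ with $s,t\in S$, $w\in W^{(1)}$ implies $a_s=a_t$ and $(n_swn_t^{-1}w^{-1})\,w(b_t)=b_s$,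 where $w$ acts on $R[T]$ through conjugation on $T$. The generic pro-$p$ Hecke algebra $\mathcal H^{(1)}$ is the $R$-algebra generated by elements $T_w$, $w\in W^{(1)}$, with relations $T_1=1$, $T_{ww'}=T_wT_{w'}$ if $\ell(ww')=\ell(w)+\ell(w')$, and $T_{n_s}^2=a_sT_{n_s^2}+T_{n_s}b_s$ for $s\in S$, where $t\in T$ is read as $T_t$ in $b_s$. An *orientation* of $W_{\mathrm{aff}}$ is a map $\mathfrak o:W_{\mathrm{aff}}\times S\to\{\pm1\}$ such that $\mathfrak o(vs,s)=-\mathfrak o(v,s)$ and such that, for $s,t\in S$ with $m=m(s,t)<\infty$ and every $v$, there are $0\le k\le m$ and $\varepsilon\in\{\pm1\}$ for which the sequences of length $m$ $$(\mathfrak o(v,s),\mathfrak o(vs,t),\mathfrak o(vst,s),\dots),\qquad(\mathfrak o(v,t),\mathfrak o(vt,s),\mathfrak o(vts,t),\dots)$$ consist of $k$ entries $\varepsilon$ followed by $m-k$ entries $-\varepsilon$, and of $m-k$ entries $-\varepsilon$ followed by $k$ entries $\varepsilon$, respectively. It is extended to $W\times S$ by $\mathfrak o(vu,s)=\mathfrak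 o(v,u(s))$ ($v\in W_{\mathrm{aff}}$, $u\in\Omega$) and to $W^{(1)}\times S$ through $\pi$; these extensions form the set $\mathcal O$ of orientations. The groups $W$ and $W^{(1)}$ act on $\mathcal O$ from the right by $(\mathfrak o\bullet w)(w',s)=\mathfrak o(ww',s)$. Let $\mathfrak H=\{vsv^{-1}:v\in W_{\mathrm{aff}},s\in S\}$ be the set of walls. A wall $H$ separates $v,v'\in W_{\mathrm{aff}}$ if exactly one of $\ell(v)<\ell(Hv)$ and $\ell(v')<\ell(Hv')$ holds. For elements of $W$, separation refers to their $W_{\mathrm{aff}}$-components. Let $\mathbf N[\mathfrak H]$ be the free commutative monoid on symbols $\mathbf a_H$, and let $\mathbf N[\mathfrak H]\to R$, $x\mapsto\overline x$, be the multiplicative map with $\mathbf a_H\mapsto a_s$ for any $s\in S$ conjugate to $H$ in $W$. For $w,w'\in W$ let $\mathbf X(w,w')=\prod_H\mathbf a_H$ over all walls $H$ that separate both $1$ from $w$ and $w$ from $ww'$; for $w,w'\in W^{(1)}$ let $\overline{\mathbb X}(w,w')=\overline{\mathbf X(\pi(w),\pi(w'))}\in R$. Let $\mathfrak A(W^{(1)})$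 be the group with generators $T_w$ ($w\in W^{(1)}$) and relations $T_{ww'}=T_wT_{w'}$ whenever $\ell(ww')=\ell(w)+\ell(w')$. **Theorem.** 0. The elements $T_w$, $w\in W^{(1)}$, form an $R$-basis of $\mathcal H^{(1)}$. 1. For every $\mathfrak o\in\mathcal O$ there is a unique map $\widehat\theta_{\mathfrak o}:W^{(1)}\to\mathcal H^{(1)}$ such that, whenever $w=n_{s_1}\cdots n_{s_r}u$ with $s_i\in S$, $u\in\Omega^{(1)}$ and $\ell(w)=r$, $$\widehat\theta_{\mathfrak o}(w)=T_1\cdots T_r\,T_u,\qquad T_i=\begin{cases}T_{n_{s_i}}&\text{if }\mathfrak o(s_1\cdots s_{i-1},s_i)=+1,\\ T_{n_{s_i}}-b_{s_i}&\text{if }\mathfrak o(s_1\cdots s_{i-1},s_i)=-1.\end{cases}$$ 2. For every $\mathfrak o\in\mathcal O$ there is a unique map $\gamma_{\mathfrak o}:W\to\mathbf N[\mathfrak H]$ such that $\gamma_{\mathfrak o}(w)=\prod_{i:\,\varepsilon_i=-1}\mathbf a_{H_i}$ whenever $w=s_1\cdots s_ru$ with $s_i\in S$, $u\in\Omega$ and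 $\ell(w)=r$, where $\varepsilon_i=\mathfrak o(s_1\cdots s_{i-1},s_i)$ and $H_i=(s_1\cdots s_{i-1})s_i(s_1\cdots s_{i-1})^{-1}$. There is a unique family of maps $\theta_{\mathfrak o}:W^{(1)}\to\mathfrak A(W^{(1)})$, $\mathfrak o\in\mathcal O$, with $\theta_{\mathfrak o}(ww')=\theta_{\mathfrak o}(w)\theta_{\mathfrak o\bullet w}(w')$ for all $w,w'\in W^{(1)}$, with $\theta_{\mathfrak o}(n_s)=T_{n_s}$ if $\mathfrak o(1,s)=+1$ and $\theta_{\mathfrak o}(n_s)=(T_{n_s^{-1}})^{-1}$ if $\mathfrak o(1,s)=-1$, and with $\theta_{\mathfrak o}(u)=T_u$ for $u\in\Omega^{(1)}$. If all $a_s$ are units in $R$, then $T_w\mapsto T_w$ defines a multiplicative map $\varphi:\mathfrak A(W^{(1)})\to\mathcal H^{(1)}$, and for all $\mathfrak o\in\mathcal O$ and $w\in W^{(1)}$ $$\widehat\theta_{\mathfrak o}(w)=\overline{\gamma_{\mathfrak o}(\pi(w))}\;\varphi(\theta_{\mathfrak o}(w)).$$ 3. For all $\mathfrak o\in\mathcal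 O$ and $w,w'\in W^{(1)}$ $$\widehat\theta_{\mathfrak o}(w)\,\widehat\theta_{\mathfrak o\bullet w}(w')=\overline{\mathbb X}(w,w')\,\widehat\theta_{\mathfrak o}(ww').$$ -/

import Mathlib

noncomputable section

namespace ProPHecke

/-- The alternating product `x * y * x * ...` with a given number of factors. -/
def altProd {G : Type*} [Monoid G] : G → G → ℕ → G
  | _, _, 0 => 1
  | x, y, k + 1 => x * altProd y x k

/-! ### Extended Coxeter groups -/

/-- An extended Coxeter group: a group `W` that is the internal semidirect product of a normal
subgroup `Waff`, which is a Coxeter group with simple reflections indexed by `B`, and a subgroup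
`Ω` whose conjugation action on `Waff` restricts to an action `act` on the simple reflections.
The homomorphism `W → Ω` is the projection along `Waff`. -/
structure ExtendedCoxeterGroup (B W : Type*) [Group W] where
  Waff : Subgroup W
  Ω : Subgroup W
  normal : Waff.Normal
  compl : Subgroup.IsComplement' Waff Ω
  M : CoxeterMatrix B
  cs : CoxeterSystem M Waff
  act : Ω →* Equiv.Perm B
  conj_simple : ∀ (u : Ω) (s : B),
    (u : W) * (cs.simple s : W) * (u : W)⁻¹ = (cs.simple (act u s) : W)

namespace ExtendedCoxeterGroup

variable {B W : Type*} [Group W] (E : ExtendedCoxeterGroup B W)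

/-- The simple reflection attached to `s`, as an element of `W`. -/
def simple (s : B) : W := (E.cs.simple s : W)

/-- The order `m(s,t)` of the product `st`, with the convention that `0` stands for `∞`. -/
def m (s t : B) : ℕ := orderOf (E.cs.simple s * E.cs.simple t)

/-- The chamber `w • 1` of `w`: the component `v` in the decomposition `w = v * u` with `v` in
`Waff` and `u` in `Ω`. -/
def chamber (w : W) : E.Waff := (E.compl.equiv w).1

/-- The length function of `W`, extended from `Waff` so that `ℓ (v * u) = ℓ v`. -/
def length (w : W) : ℕ := E.cs.length (E.chamber w)

/-! ### Walls -/

/-- The walls (hyperplanes): the conjugates in `Waff` of the simple reflections. -/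
def Wall : Type _ := {t : E.Waff // E.cs.IsReflection t}

/-- The wall `v s v⁻¹` between the adjacent chambers `v` and `v s`. -/
def wall (v : E.Waff) (s : B) : E.Wall := ⟨v * E.cs.simple s * v⁻¹, v, s, rfl⟩

/-- The wall `H` separates the chambers `v` and `v'` if they lie in different half-spaces;
the half-space of `H` that contains the chamber `1` is the set of all `v` with `ℓ v < ℓ (H v)`. -/
def Separates (H : E.Wall) (v v' : E.Waff) : Prop :=
  ¬ (E.cs.length v < E.cs.length (H.1 * v) ↔ E.cs.length v' < E.cs.length (H.1 * v'))

/-- The free abelian monoid on the walls. It is written additively: an element is the vector of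
exponents of a formal product of walls. -/
abbrev WallMonoid : Type _ := E.Wall →₀ ℕ

/-- The formal product `X(w,w')` of all walls that separate both `1` from `w` and `w` from
`w w'` (each occurring once). -/
def X (w w' : W) : E.WallMonoid :=
  ∑ᶠ H ∈ {H : E.Wall | E.Separates H 1 (E.chamber w) ∧
    E.Separates H (E.chamber w) (E.chamber (w * w'))}, Finsupp.single H 1

/-- The parameter `a_H` of a wall `H`: it is `a s` for a simple reflection `s` conjugate to `H`
(for admissible parameters it does not depend on the choice of `s`). -/
def aWall {R : Type*} (a : B → R) (H : E.Wall) : R :=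
  a H.2.choose_spec.choose

/-- The specialization from formal products of walls to `R` that replaces `H` by `a_H`. -/
def specialize {R : Type*} [CommRing R] (a : B → R) (x : E.WallMonoid) : R :=
  x.prod fun H k => E.aWall a H ^ k

/-! ### Orientations -/

/-- The sequence of signs of the crossings in the gallery `v, vs, vst, vsts, ...`. -/
def signSeq (o : E.Waff → B → ℤˣ) (v : E.Waff) (s t : B) (i : ℕ) : ℤˣ :=
  o (v * altProd (E.cs.simple s) (E.cs.simple t) i) (if Even i then s else t)

/-- Orientations of the Coxeter group `Waff`. The sign `ε` in the second axiom tells which of the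
two forms `(+,…,+,-,…,-), (-,…,-,+,…,+)` and `(-,…,-,+,…,+), (+,…,+,-,…,-)` occurs. -/
structure IsCoxeterOrientation (o : E.Waff → B → ℤˣ) : Prop where
  neg : ∀ (v : E.Waff) (s : B), o (v * E.cs.simple s) s = - o v s
  dihedral : ∀ (s t : B), E.m s t ≠ 0 → ∀ v : E.Waff, ∃ k ≤ E.m s t, ∃ ε : ℤˣ,
    (∀ i < E.m s t, E.signSeq o v s t i = if i < k then ε else -ε) ∧
    (∀ i < E.m s t, E.signSeq o v t s i = if i < E.m s t - k then -ε else ε)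

/-- `f` is an orientation of `W`: it is associated to an orientation `o` of `Waff` by the rule
`f (v u, s) = o (v, u(s))`. -/
def IsOrientation (f : W → B → ℤˣ) : Prop :=
  ∃ o : E.Waff → B → ℤˣ, E.IsCoxeterOrientation o ∧
    ∀ (v : E.Waff) (u : E.Ω) (s : B), f ((v : W) * (u : W)) s = o v (E.act u s)

/-- The set of orientations of `W`. An orientation of a pro-`p` Coxeter group over `W` is by
definition the pullback of an orientation of `W` along the surjection to `W`, so this is also the
set of orientations of any pro-`p` Coxeter group over `W`. -/
def Orientation : Type _ := {f : W → B → ℤˣ // E.IsOrientation f}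

theorem map_altProd {G G' : Type*} [Monoid G] [Monoid G'] (φ : G →* G') (x y : G) (k : ℕ) :
    φ (altProd x y k) = altProd (φ x) (φ y) k := by
  induction k generalizing x y with
  | zero => simp [altProd]
  | succ k ih => simp [altProd, ih]

theorem isOrientation_act {f : W → B → ℤˣ} (hf : E.IsOrientation f) (w : W) :
    E.IsOrientation (fun w' s => f (w * w') s) := by
  have := E.normal
  obtain ⟨o, ho, hfo⟩ := hf
  obtain ⟨⟨v₁, u₁⟩, hw⟩ := E.compl.2 w
  simp only at hw
  set c : E.Waff →* E.Waff := (MulAut.conjNormal (u₁ : W) : MulAut E.Waff).toMonoidHom with hc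
  have hcv : ∀ v : E.Waff, (c v : W) = (u₁ : W) * v * (u₁ : W)⁻¹ := fun v => by
    simp [hc, MulAut.conjNormal_apply]
  have hcs : ∀ s, c (E.cs.simple s) = E.cs.simple (E.act u₁ s) := fun s => by
    apply Subtype.ext
    rw [hcv, E.conj_simple]
  have hm : ∀ s t, E.m (E.act u₁ s) (E.act u₁ t) = E.m s t := fun s t => by
    unfold m
    rw [← hcs, ← hcs, ← map_mul]
    exact orderOf_injective c (MulAut.conjNormal (u₁ : W) : MulAut E.Waff).injective _
  have hsig : ∀ v s t i, E.signSeq (fun v s => o (v₁ * c v) (E.act u₁ s)) v s t i =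
      E.signSeq o (v₁ * c v) (E.act u₁ s) (E.act u₁ t) i := fun v s t i => by
    simp only [signSeq, map_mul, map_altProd, hcs, mul_assoc]
    split_ifs <;> rfl
  refine ⟨fun v s => o (v₁ * c v) (E.act u₁ s), ⟨fun v s => ?_, fun s t hst v => ?_⟩,
    fun v u s => ?_⟩
  · simp only [map_mul, hcs, ← mul_assoc]
    exact ho.neg _ _
  · obtain ⟨k, hk, ε, h₁, h₂⟩ := ho.dihedral (E.act u₁ s) (E.act u₁ t) (by rwa [hm]) (v₁ * c v)
    have hm' := hm t s
    rw [hm] at hk h₁ h₂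
    exact ⟨k, hk, ε, fun i hi => by rw [hsig]; exact h₁ i hi,
      fun i hi => by rw [hsig]; exact h₂ i hi⟩
  · have h := hfo (v₁ * c v) (u₁ * u) s
    have e : w * ((v : W) * (u : W)) = ((v₁ * c v : E.Waff) : W) * ((u₁ * u : E.Ω) : W) := by
      rw [← hw, Subgroup.coe_mul, Subgroup.coe_mul, hcv]
      group
    simp only [e, h, map_mul, Equiv.Perm.mul_apply]

/-- The right action `(o • w)(w', s) = o (w w', s)` of `W` on its orientations. -/
def Orientation.act {E : ExtendedCoxeterGroup B W} (o : E.Orientation) (w : W) : E.Orientation :=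
  ⟨fun w' s => o.1 (w * w') s, E.isOrientation_act o.2 w⟩

/-- The formal product of the walls that are crossed in the negative direction, with respect to
`o`, by the gallery `v, v s₁, v s₁ s₂, ...` given by a word `s₁ s₂ ...`. -/
def negWalls (o : E.Orientation) : E.Waff → List B → E.WallMonoid
  | _, [] => 0
  | v, s :: l => (if o.1 v s = -1 then Finsupp.single (E.wall v s) 1 else 0) +
      negWalls o (v * E.cs.simple s) l

/-- The defining property of the map `γ_o`: for every reduced expression `w = s₁ ⋯ s_r u`, its
value at `w` is the product of the walls crossed negatively by the corresponding gallery. -/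
def IsNegWallProduct (o : E.Orientation) (γ : W → E.WallMonoid) : Prop :=
  ∀ (l : List B) (u : E.Ω), E.length ((l.map E.simple).prod * (u : W)) = l.length →
    γ ((l.map E.simple).prod * (u : W)) = E.negWalls o 1 l

end ExtendedCoxeterGroup

/-! ### Pro-`p` Coxeter groups -/

/-- A pro-`p` Coxeter group `W1` over the extended Coxeter group `E`: an extension
`π : W1 → W` with abelian kernel, and lifts `n s` of the simple reflections that satisfy the
braid relations. -/
structure ProPCoxeterGroup {B W : Type*} [Group W] (E : ExtendedCoxeterGroup B W)
    (W1 : Type*) [Group W1] where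
  π : W1 →* W
  surj : Function.Surjective π
  comm : ∀ x ∈ π.ker, ∀ y ∈ π.ker, x * y = y * x
  n : B → W1
  π_n : ∀ s, π (n s) = E.simple s
  braid : ∀ s t, E.m s t ≠ 0 → altProd (n s) (n t) (E.m s t) = altProd (n t) (n s) (E.m s t)

namespace ProPCoxeterGroup

variable {B W W1 : Type*} [Group W] [Group W1] {E : ExtendedCoxeterGroup B W}
  (P : ProPCoxeterGroup E W1)

/-- The abelian normal subgroup `T`. -/
abbrev T : Subgroup W1 := P.π.ker

/-- The length function of `W1`. -/
def length (w : W1) : ℕ := E.length (P.π w)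

/-- The preimage of `Ω` in `W1`. -/
def Ω1 : Subgroup W1 := E.Ω.comap P.π

theorem mem_T {s t : B} {w : W1} (h : E.simple s * P.π w = P.π w * E.simple t) :
    P.n s * w * (P.n t)⁻¹ * w⁻¹ ∈ P.T := by
  simp only [MonoidHom.mem_ker, map_mul, map_inv, P.π_n, h]
  group

/-- The admissible parameters: families `a s` in `R` and `b s` in `R[T]` such that `s π(w) = π(w) t`
implies `a s = a t` and `(n_s w n_t⁻¹ w⁻¹) w(b_t) = b_s`, where `w` acts on `R[T]` through the
conjugation action on `T`. -/
def IsParameter {R : Type*} [CommRing R] (a : B → R) (b : B → MonoidAlgebra R P.T) : Prop :=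
  ∀ (s t : B) (w : W1) (h : E.simple s * P.π w = P.π w * E.simple t),
    a s = a t ∧
    MonoidAlgebra.single (⟨P.n s * w * (P.n t)⁻¹ * w⁻¹, P.mem_T h⟩ : P.T) (1 : R) *
      MonoidAlgebra.mapDomain (fun x : P.T => MulAut.conjNormal w x) (b t) = b s

/-! ### The generic pro-`p` Hecke algebra -/

/-- The defining relations of the generic pro-`p` Hecke algebra, in generators `T_w`, `w ∈ W1`. -/
inductive HeckeRel {R : Type*} [CommRing R] (a : B → R) (b : B → MonoidAlgebra R P.T) :
    FreeAlgebra R W1 → FreeAlgebra R W1 → Prop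
  | one : HeckeRel a b (FreeAlgebra.ι R 1) 1
  | mul (w w' : W1) (h : P.length (w * w') = P.length w + P.length w') :
      HeckeRel a b (FreeAlgebra.ι R (w * w')) (FreeAlgebra.ι R w * FreeAlgebra.ι R w')
  | quad (s : B) :
      HeckeRel a b (FreeAlgebra.ι R (P.n s) * FreeAlgebra.ι R (P.n s))
        (a s • FreeAlgebra.ι R (P.n s * P.n s) +
          FreeAlgebra.ι R (P.n s) * (b s).coeff.sum fun t r => r • FreeAlgebra.ι R (t : W1))

/-- The generic pro-`p` Hecke algebra with parameters `a` and `b`. For admissible parameters the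
generators `T_w` form an `R`-basis, so that this is the free `R`-module on `W1` with its unique
`R`-algebra structure in which `T_{ww'} = T_w T_{w'}` when lengths add, and
`T_{n_s}² = a_s T_{n_s²} + T_{n_s} b_s`. -/
abbrev HeckeAlgebra {R : Type*} [CommRing R] (a : B → R) (b : B → MonoidAlgebra R P.T) : Type _ :=
  RingQuot (P.HeckeRel a b)

section

variable {R : Type*} [CommRing R] (a : B → R) (b : B → MonoidAlgebra R P.T)

/-- The element `T_w` of the Hecke algebra. -/
def heckeT (w : W1) : P.HeckeAlgebra a b :=
  RingQuot.mkAlgHom R (P.HeckeRel a b) (FreeAlgebra.ι R w)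

/-- The map from `R[T]` to the Hecke algebra that sends `t` to `T_t`. -/
def ofRT (x : MonoidAlgebra R P.T) : P.HeckeAlgebra a b :=
  x.coeff.sum fun t r => r • P.heckeT a b (t : W1)

/-- The product `T_1 ⋯ T_r` along the gallery `v, v s_1, v s_1 s_2, …`, where `T_i` is `T_{n_{s_i}}`
or `T_{n_{s_i}} - b_{s_i}` according to the sign that `o` gives to the `i`-th crossing. -/
def intProd (o : E.Orientation) : W → List B → P.HeckeAlgebra a b
  | _, [] => 1
  | v, s :: l => (if o.1 v s = 1 then P.heckeT a b (P.n s)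
      else P.heckeT a b (P.n s) - P.ofRT a b (b s)) * intProd o (v * E.simple s) l

/-- The defining property of the integral Bernstein map attached to `o`: for every reduced
expression `w = n_{s_1} ⋯ n_{s_r} u` the value at `w` is `T_1 ⋯ T_r T_u`. -/
def IsIntegralBernstein (o : E.Orientation) (f : W1 → P.HeckeAlgebra a b) : Prop :=
  ∀ (l : List B) (u : P.Ω1), P.length ((l.map P.n).prod * (u : W1)) = l.length →
    f ((l.map P.n).prod * (u : W1)) = P.intProd a b o 1 l * P.heckeT a b (u : W1)

end

/-! ### The braid group and the unnormalized Bernstein map -/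

/-- The generalized braid group, with generators `T_w` for `w ∈ W1` and relations
`T_{ww'} = T_w T_{w'}` whenever `ℓ(ww') = ℓ(w) + ℓ(w')`. -/
abbrev BraidGroup : Type _ :=
  PresentedGroup {r : FreeGroup W1 | ∃ w w' : W1, P.length (w * w') = P.length w + P.length w' ∧
    r = FreeGroup.of (w * w') * (FreeGroup.of w * FreeGroup.of w')⁻¹}

/-- The generator `T_w` of the braid group. -/
def braidT (w : W1) : P.BraidGroup := PresentedGroup.of w

/-- The defining properties of the (unnormalized) Bernstein map `θ`, with values in the braid
group: the cocycle rule and the values at `n_s` and on the preimage of `Ω`. -/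
structure IsBernsteinMap (θ : E.Orientation → W1 → P.BraidGroup) : Prop where
  cocycle : ∀ (o : E.Orientation) (w w' : W1), θ o (w * w') = θ o w * θ (o.act (P.π w)) w'
  simple : ∀ (o : E.Orientation) (s : B),
    θ o (P.n s) = if o.1 1 s = 1 then P.braidT (P.n s) else (P.braidT ((P.n s)⁻¹))⁻¹
  omega : ∀ (o : E.Orientation) (u : P.Ω1), θ o (u : W1) = P.braidT (u : W1)

end ProPCoxeterGroup

end ProPHecke

end

/-! Basis. The span of the `T_w` is a left ideal containing `1`, because the quadratic relation
resolves `T_{n_s} T_w` when `s` shortens `w`. For independence, the Hecke algebra is made to act on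
`R[W1]`. There `T_{n_s}` multiplies `w` from the left by `n_s`, or by `a_s n_s + b_s` if `s`
shortens `w`, and there are mirror operators on the right. Left and right operators commute
(`IsParameter.leftOp_comm_rightOp`); this is where the condition on the parameters is used. An
operator commuting with the right ones is determined by its value at `1`, so all relations can be
checked there, and `T_w` sends `1` to `w`.

Walls. A function on crossings that is odd and agrees on the two galleries around each rank two
residue has sums along galleries that depend only on the end points (`exists_crossingCocycle`). The
constant `1` mod 2 gives inversions and strong exchange; an orientation gives signed sums. A
crossing of sign `ε` contributes `(1 - ε)/2` to the negative crossings, so `2γ_o(w)` is the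
inversion indicator minus the signed sum, and `γ_o` is well defined. Comparing `w`, `w'` and `ww'`,
the signed sums cancel and the walls crossed twice remain, which is `X(w,w')`.

The maps `θ_o`. The cocycle rule says that `w ↦ (o ↦ θ_o(w), w)` is a homomorphism into a semidirect
product that splits the projection to `W1`. It is built by generators and relations; the braid
relation is the dihedral axiom for orientations.

Product rule. One has `T_{n_s} - b_s = a_s T_{n_s⁻¹}⁻¹` when the `a_s` are units. Then the integral
map is `γ_o` specialized times `φ ∘ θ_o`, and the product rule follows from the cocycle rule and the
identity for `γ`. For arbitrary parameters, `a_s` is deformed to `X + a_s` over `R[X]`, a unit in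
the total ring of fractions. Since Hecke algebras are free, the rule descends from the fractions to
`R[X]`; then `X` is set to `0`. -/

namespace ProPHecke

/-! ### Alternating products -/

section AltProd

variable {G : Type*} [Monoid G]

theorem isUnit_altProd {x y : G} (hx : IsUnit x) (hy : IsUnit y) (k : ℕ) :
    IsUnit (altProd x y k) := by
  induction k generalizing x y with
  | zero => exact isUnit_one
  | succ k ih => exact hx.mul (ih hy hx)

theorem altProd_add (x y : G) (j k : ℕ) :
    altProd x y (j + k) =
      altProd x y j * altProd (if Even j then x else y) (if Even j then y else x) k := by
  induction j generalizing x y with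
  | zero => simp [altProd]
  | succ j ih =>
    rw [Nat.add_right_comm, altProd, altProd, ih, mul_assoc]
    by_cases h : Even j <;> simp [h, Nat.even_add_one]

/-- The power is an alternating word of `2k` letters whose last `k` letters cancel against the
second factor. -/
theorem mul_pow_mul_altProd {x y : G} (hx : x * x = 1) (hy : y * y = 1) (k : ℕ) :
    (x * y) ^ k * altProd y x k = altProd x y k := by
  induction k generalizing x y with
  | zero => simp [altProd]
  | succ k ih =>
    have h : (x * y) ^ (k + 1) = x * (y * x) ^ k * y := by
      rw [pow_succ', mul_assoc, mul_assoc, ← (SemiconjBy.pow_right (show SemiconjBy y (x * y) (y * x)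
        by simp [SemiconjBy, mul_assoc]) k).eq]
    rw [h, altProd, altProd, mul_assoc, ← mul_assoc y, hy, one_mul, mul_assoc, ih hy hx]

theorem mul_pow_eq_one_of_altProd_eq {x y : G} (hx : x * x = 1) (hy : y * y = 1) {k : ℕ}
    (h : altProd x y k = altProd y x k) : (x * y) ^ k = 1 := by
  have hu := isUnit_altProd ⟨⟨x, x, hx, hx⟩, rfl⟩ ⟨⟨y, y, hy, hy⟩, rfl⟩ k
  have := mul_pow_mul_altProd hx hy k
  rw [← h] at this
  exact hu.mul_right_cancel (by rw [this, one_mul])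

/-- The inverse is the reversed word, which ends in `y`; since the next letter is `x`, nothing
cancels. The parity of `j` decides the initial letter. -/
theorem inv_altProd_mul_altProd {G : Type*} [Group G] {x y : G} (hx : x * x = 1) (hy : y * y = 1)
    (j k : ℕ) : (altProd y x j)⁻¹ * altProd x y k = altProd x y (j + k) ∨
      (altProd y x j)⁻¹ * altProd x y k = altProd y x (j + k) := by
  induction j generalizing x y k with
  | zero => simp [altProd]
  | succ j ih =>
    have h : (altProd y x (j + 1))⁻¹ * altProd x y k = (altProd x y j)⁻¹ * altProd y x (k + 1) := by
      rw [altProd, altProd, mul_inv_rev, mul_assoc, inv_eq_of_mul_eq_one_right hy]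
    rw [h, Nat.add_right_comm, add_assoc]
    exact (ih hy hx (k + 1)).symm

end AltProd

end ProPHecke

/-- A transition on `X` with values in `C`: it moves a state and records a value. -/
@[ext] structure ProPHecke.Transition (X C : Type*) where
  next : X → X
  val : X → C

namespace ProPHecke.Transition

variable {X C : Type*} [AddMonoid C]

/-- Composition of transitions, from left to right; the recorded values are added. -/
instance : Monoid (Transition X C) where
  mul f g := ⟨fun x => g.next (f.next x), fun x => f.val x + g.val (f.next x)⟩
  one := ⟨fun x => x, fun _ => 0⟩
  mul_assoc f g h := Transition.ext rfl (funext fun _ => add_assoc _ _ _)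
  one_mul f := Transition.ext rfl (funext fun _ => zero_add _)
  mul_one f := Transition.ext rfl (funext fun _ => add_zero _)

@[simp] theorem one_next (x : X) : (1 : Transition X C).next x = x := rfl

@[simp] theorem one_val (x : X) : (1 : Transition X C).val x = 0 := rfl

@[simp] theorem mul_next (f g : Transition X C) (x : X) :
    (f * g).next x = g.next (f.next x) := rfl

@[simp] theorem mul_val (f g : Transition X C) (x : X) :
    (f * g).val x = f.val x + g.val (f.next x) := rfl

end ProPHecke.Transition

/-! ### Crossing cocycles and inversions in Coxeter groups -/

namespace CoxeterSystem

open ProPHecke MulOpposite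

variable {B G : Type*} [Group G] {M : CoxeterMatrix B} (cs : CoxeterSystem M G)

/-- Braid relations are assumed for the order of `st`, which a priori only divides `M s t`; that is
enough for the Coxeter relations. If the order is `0`, then `M s t = 0` and nothing is required. -/
theorem isLiftable_of_altProd_eq {H : Type*} [Monoid H] {f : B → H} (hsq : ∀ s, f s * f s = 1)
    (hbraid : ∀ s t, orderOf (cs.simple s * cs.simple t) ≠ 0 →
      altProd (f s) (f t) (orderOf (cs.simple s * cs.simple t)) =
        altProd (f t) (f s) (orderOf (cs.simple s * cs.simple t))) : M.IsLiftable f := by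
  intro s t
  obtain ⟨c, hc⟩ := orderOf_dvd_of_pow_eq_one (cs.simple_mul_simple_pow s t)
  by_cases h : orderOf (cs.simple s * cs.simple t) = 0
  · rw [hc, h, zero_mul, pow_zero]
  · rw [hc, pow_mul, mul_pow_eq_one_of_altProd_eq (hsq s) (hsq t) (hbraid s t h), one_pow]

/-- The letter and chamber of the `i`-th crossing of an alternating gallery, fed to `f`. -/
def crossingSeq {A : Type*} (f : G → B → A) (v : G) (s t : B) (i : ℕ) : A :=
  f (v * altProd (cs.simple s) (cs.simple t) i) (if Even i then s else t)

theorem crossingSeq_succ {A : Type*} (f : G → B → A) (v : G) (s t : B) (i : ℕ) :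
    cs.crossingSeq f v s t (i + 1) = cs.crossingSeq f (v * cs.simple s) t s i := by
  simp only [crossingSeq, altProd, mul_assoc, Nat.even_add_one]
  by_cases h : Even i <;> simp [h]

theorem crossingSeq_wall (v : G) (s t : B) (i : ℕ) :
    cs.crossingSeq (fun v s => v * cs.simple s * v⁻¹) v s t i =
      v * ((cs.simple s * cs.simple t) ^ i * cs.simple s) * v⁻¹ := by
  induction i generalizing v s t with
  | zero => simp [crossingSeq, altProd]
  | succ i ih =>
    rw [crossingSeq_succ, ih]
    have : (cs.simple s * cs.simple t) ^ (i + 1) * cs.simple s =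
        cs.simple s * ((cs.simple t * cs.simple s) ^ i * cs.simple t) * (cs.simple s)⁻¹ := by
      rw [pow_succ', cs.inv_simple, mul_assoc _ _ (cs.simple s), mul_assoc _ _ (cs.simple s),
        ← (SemiconjBy.pow_right (show SemiconjBy (cs.simple t) (cs.simple s * cs.simple t)
          (cs.simple t * cs.simple s) by simp [SemiconjBy, mul_assoc]) i).eq]
      simp only [mul_assoc]
    rw [this]
    group

/-- The two galleries around a rank two residue cross the same walls in opposite order, because
`(st)^m = 1` gives `(st)^i s = (ts)^(m-1-i) t`. -/
theorem sum_crossingSeq_eq {A : Type*} [AddCommGroup A] {f : G → B → A} {s t : B} {v : G}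
    (hpal : ∀ i < orderOf (cs.simple s * cs.simple t), cs.crossingSeq f v s t i =
      cs.crossingSeq f v t s (orderOf (cs.simple s * cs.simple t) - 1 - i)) :
    ∑ i ∈ Finset.range (orderOf (cs.simple s * cs.simple t)),
      Finsupp.single (cs.crossingSeq (fun v s => v * cs.simple s * v⁻¹) v s t i)
        (cs.crossingSeq f v s t i) =
    ∑ i ∈ Finset.range (orderOf (cs.simple s * cs.simple t)),
      Finsupp.single (cs.crossingSeq (fun v s => v * cs.simple s * v⁻¹) v t s i)
        (cs.crossingSeq f v t s i) := by
  rw [← Finset.sum_range_reflect (fun i => Finsupp.single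
    (cs.crossingSeq (fun v s => v * cs.simple s * v⁻¹) v t s i) (cs.crossingSeq f v t s i))]
  refine Finset.sum_congr rfl fun i hi => ?_
  rw [Finset.mem_range] at hi
  rw [hpal i hi, crossingSeq_wall, crossingSeq_wall]
  set m := orderOf (cs.simple s * cs.simple t)
  have hinv : cs.simple t * cs.simple s = (cs.simple s * cs.simple t)⁻¹ := by simp
  have hpow : (cs.simple s * cs.simple t) ^ (i + 1) =
      ((cs.simple s * cs.simple t) ^ (m - 1 - i))⁻¹ := by
    rw [eq_inv_iff_mul_eq_one, ← pow_add, show i + 1 + (m - 1 - i) = m by omega,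
      pow_orderOf_eq_one]
  have key : (cs.simple s * cs.simple t) ^ i * cs.simple s =
      (cs.simple t * cs.simple s) ^ (m - 1 - i) * cs.simple t := by
    rw [hinv, inv_pow, ← hpow, pow_succ]
    simp [mul_assoc]
  rw [key]

/-- A function `f` on the crossings of walls that is odd under reversal of crossings and takes the
same values on the two galleries around a rank two residue adds up along galleries to a formal
combination of walls that only depends on the end points. -/
theorem exists_crossingCocycle {A : Type*} [AddCommGroup A] (f : G → B → A)
    (hneg : ∀ v s, f (v * cs.simple s) s = - f v s)
    (hpal : ∀ s t, orderOf (cs.simple s * cs.simple t) ≠ 0 → ∀ v,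
      ∀ i < orderOf (cs.simple s * cs.simple t), cs.crossingSeq f v s t i =
        cs.crossingSeq f v t s (orderOf (cs.simple s * cs.simple t) - 1 - i)) :
    ∃ D : G → G → G →₀ A,
      (∀ v s, D v (cs.simple s) = Finsupp.single (v * cs.simple s * v⁻¹) (f v s)) ∧
      ∀ v w w', D v (w * w') = D v w + D (v * w) w' := by
  -- A homomorphism from `G` to transitions is an action together with a cocycle. Hence the
  -- universal property of the Coxeter group produces `D`: oddness gives the involution relation,
  -- `hpal` the braid relation.
  let F : B → Transition G (G →₀ A) := fun s => ⟨fun v => v * cs.simple s,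
    fun v => Finsupp.single (v * cs.simple s * v⁻¹) (f v s)⟩
  have hnext : ∀ s t k v, (altProd (F s) (F t) k).next v =
      v * altProd (cs.simple s) (cs.simple t) k := by
    intro s t k
    induction k generalizing s t with
    | zero => simp [altProd]
    | succ k ih => intro v; rw [altProd, Transition.mul_next, ih]; simp [altProd, F, mul_assoc]
  have hval : ∀ s t k v, (altProd (F s) (F t) k).val v = ∑ i ∈ Finset.range k,
        Finsupp.single (cs.crossingSeq (fun v s => v * cs.simple s * v⁻¹) v s t i)
          (cs.crossingSeq f v s t i) := by
    intro s t k
    induction k generalizing s t with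
    | zero => simp [altProd]
    | succ k ih =>
      intro v
      rw [altProd, Transition.mul_val, ih, Finset.sum_range_succ', add_comm]
      simp [crossingSeq_succ, F]
      simp [crossingSeq, altProd]
  have hsq : ∀ s, F s * F s = 1 := fun s => by
    ext v : 2
    · simp [F]
    · simp only [F, Transition.mul_val, hneg, Transition.one_val]
      rw [show v * cs.simple s * cs.simple s * (v * cs.simple s)⁻¹ =
        v * cs.simple s * v⁻¹ by simp [mul_assoc], ← Finsupp.single_add]
      simp
  have hlift : M.IsLiftable F := cs.isLiftable_of_altProd_eq hsq fun s t hst => by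
    ext v : 2
    · rw [hnext, hnext]
      have := mul_pow_mul_altProd (cs.simple_mul_simple_self s) (cs.simple_mul_simple_self t)
        (orderOf (cs.simple s * cs.simple t))
      rw [pow_orderOf_eq_one, one_mul] at this
      rw [this]
    · rw [hval, hval, cs.sum_crossingSeq_eq (hpal s t hst v)]
  let φ := cs.lift ⟨F, hlift⟩
  have hφs : ∀ s, φ (cs.simple s) = F s := fun s => cs.lift_apply_simple hlift s
  have hφ : ∀ w v, (φ w).next v = v * w := by
    intro w
    induction w using cs.simple_induction_left with
    | one => simp
    | mul_simple_left w s ih => intro v; rw [map_mul, hφs]; simp [ih, F, mul_assoc]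
  refine ⟨fun v w => (φ w).val v, fun v s => ?_, fun v w w' => ?_⟩
  · simp [hφs, F]
  · simp [map_mul, hφ]

/-! ### Inversions and strong exchange. -/

theorem single_conj_apply {A : Type*} [Zero A] (w r t : G) (c : A) :
    Finsupp.single (w * r * w⁻¹) c t = Finsupp.single r c (w⁻¹ * t * w) := by
  classical
  simp only [Finsupp.single_apply]
  refine if_congr ?_ rfl rfl
  constructor
  · rintro rfl; group
  · rintro rfl; group

/-- The constant `1` is odd because `-1 = 1` in `ZMod 2`. As it does not see the chamber, changing
the starting chamber only conjugates the walls, so the cocycle based at `1` suffices. -/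
theorem exists_inversionCocycle : ∃ N : G → G →₀ ZMod 2,
    (∀ s, N (cs.simple s) = Finsupp.single (cs.simple s) 1) ∧
    ∀ w w' t, N (w * w') t = N w t + N w' (w⁻¹ * t * w) := by
  obtain ⟨D, hD, hmul⟩ := cs.exists_crossingCocycle (A := ZMod 2) (fun _ _ => 1)
    (fun _ _ => by decide) (fun _ _ _ _ _ _ => rfl)
  have h1 : ∀ v, D v 1 = 0 := fun v => by simpa using hmul v 1 1
  have hconj : ∀ w v t, D v w t = D 1 w (v⁻¹ * t * v) := by
    intro w
    induction w using cs.simple_induction_left with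
    | one => simp [h1]
    | mul_simple_left w s ih =>
      intro v t
      rw [hmul, hmul, hD, hD, Finsupp.add_apply, Finsupp.add_apply, ih, one_mul,
        ih (cs.simple s)]
      congr 1
      · simp only [inv_one, mul_one, single_conj_apply]
      · congr 1; group
  refine ⟨D 1, fun s => by simp [hD], fun w w' t => ?_⟩
  rw [hmul, Finsupp.add_apply, one_mul, hconj w' w]

/-- The inversion cocycle: it sends `w` to the sum modulo 2 of the reflections in the left
inversion sequence of any word for `w`. -/
noncomputable def inversionCocycle : G → G →₀ ZMod 2 := cs.exists_inversionCocycle.choose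

theorem inversionCocycle_simple (s : B) :
    cs.inversionCocycle (cs.simple s) = Finsupp.single (cs.simple s) 1 :=
  cs.exists_inversionCocycle.choose_spec.1 s

theorem inversionCocycle_mul (w w' t : G) : cs.inversionCocycle (w * w') t =
    cs.inversionCocycle w t + cs.inversionCocycle w' (w⁻¹ * t * w) :=
  cs.exists_inversionCocycle.choose_spec.2 w w' t

theorem inversionCocycle_one : cs.inversionCocycle 1 = 0 := by
  ext t; simpa using cs.inversionCocycle_mul 1 1 t

theorem inversionCocycle_wordProd (ω : List B) : cs.inversionCocycle (cs.wordProd ω) =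
    ((cs.leftInvSeq ω).map fun t => Finsupp.single t 1).sum := by
  induction ω with
  | nil => simp [inversionCocycle_one]
  | cons s ω ih =>
    ext t
    rw [wordProd_cons, inversionCocycle_mul, inversionCocycle_simple, ih, leftInvSeq,
      List.map_cons, List.sum_cons, Finsupp.add_apply]
    congr 1
    generalize cs.leftInvSeq ω = L
    induction L with
    | nil => simp
    | cons r L ih =>
      simp only [List.map_cons, List.sum_cons, Finsupp.add_apply, ih]
      congr 1
      simp only [MulAut.conj_apply, single_conj_apply]

open scoped Classical in
theorem inversionCocycle_apply_of_nodup {ω : List B} (h : (cs.leftInvSeq ω).Nodup) (t : G)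
    : cs.inversionCocycle (cs.wordProd ω) t = if t ∈ cs.leftInvSeq ω then 1 else 0 := by
  rw [inversionCocycle_wordProd]
  revert h
  generalize cs.leftInvSeq ω = L
  intro h
  induction L with
  | nil => simp
  | cons r L ih =>
    rw [List.nodup_cons] at h
    rw [List.map_cons, List.sum_cons, Finsupp.add_apply, ih h.2, Finsupp.single_apply]
    by_cases hr : r = t
    · subst hr; simp [h.1]
    · simp [hr, Ne.symm hr]

/-- For `t = w s w⁻¹` the contributions of `w` and `w⁻¹` at `t` cancel, as they add up to the value
at `w w⁻¹ = 1`. The middle letter contributes `1`. -/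
theorem IsReflection.inversionCocycle_self {t : G} (ht : cs.IsReflection t) :
    cs.inversionCocycle t t = 1 := by
  obtain ⟨w, s, rfl⟩ := ht
  have h := cs.inversionCocycle_mul w w⁻¹ (w * cs.simple s * w⁻¹)
  rw [mul_inv_cancel, inversionCocycle_one, Finsupp.zero_apply] at h
  have e : ∀ w : G, w⁻¹ * (w * cs.simple s * w⁻¹) * w = cs.simple s := fun w => by group
  rw [e] at h
  rw [mul_assoc w, inversionCocycle_mul, inversionCocycle_mul, inversionCocycle_simple,
    ← mul_assoc w, e, add_left_comm, show (cs.simple s)⁻¹ * cs.simple s * cs.simple s =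
    cs.simple s by simp, ← h]
  simp

theorem length_mul_lt_of_inversionCocycle {w t : G} (h : cs.inversionCocycle w t = 1) :
    cs.length (t * w) < cs.length w := by
  classical
  obtain ⟨ω, hω, rfl⟩ := cs.exists_isReduced w
  rw [cs.inversionCocycle_apply_of_nodup hω.nodup_leftInvSeq] at h
  refine (cs.isLeftInversion_of_mem_leftInvSeq hω ?_).2
  by_contra h'
  simp [h'] at h

/-- The strong exchange condition. -/
theorem IsReflection.inversionCocycle_eq_one_iff {t : G} (ht : cs.IsReflection t) (w : G) :
    cs.inversionCocycle w t = 1 ↔ cs.length (t * w) < cs.length w := by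
  refine ⟨cs.length_mul_lt_of_inversionCocycle, fun h => ?_⟩
  by_contra h'
  have h0 : cs.inversionCocycle w t = 0 := by
    generalize cs.inversionCocycle w t = x at *
    revert x; decide
  -- If `t` were not an inversion of `w`, it would be one of `t * w`, so `w = t * (t * w)` would be
  -- shorter than `t * w`.
  have h1 : cs.inversionCocycle (t * w) t = 1 := by
    rw [inversionCocycle_mul, ht.inversionCocycle_self, show t⁻¹ * t * t = t by group, h0, add_zero]
  have := cs.length_mul_lt_of_inversionCocycle h1
  rw [← mul_assoc, ht.mul_self, one_mul] at this
  omega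

/-- Without repetitions, the left inversion sequence lists the support of the inversion cocycle,
which depends only on the element. A reduced word for the same element lists the same set, so the
two words have equal length. -/
theorem isReduced_of_nodup_leftInvSeq {ω : List B} (h : (cs.leftInvSeq ω).Nodup) :
    cs.IsReduced ω := by
  classical
  obtain ⟨ω', hω', he⟩ := cs.exists_isReduced (cs.wordProd ω)
  have hmem : ∀ t, t ∈ cs.leftInvSeq ω ↔ t ∈ cs.leftInvSeq ω' := fun t => by
    have h1 := cs.inversionCocycle_apply_of_nodup h t
    rw [he, cs.inversionCocycle_apply_of_nodup hω'.nodup_leftInvSeq] at h1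
    by_cases a1 : t ∈ cs.leftInvSeq ω <;> by_cases a2 : t ∈ cs.leftInvSeq ω' <;>
      simp_all
  have hlen := ((List.perm_ext_iff_of_nodup h hω'.nodup_leftInvSeq).2 hmem).length_eq
  rw [length_leftInvSeq, length_leftInvSeq] at hlen
  rw [IsReduced, he, hω'.eq, hlen]

/-- If left multiplication by `s` changes its effect on the length after right multiplication by
`t`, then `s w = w t`. -/
theorem simple_mul_eq_mul_simple {w : G} {s t : B}
    (h : ¬(cs.IsLeftDescent (w * cs.simple t) s ↔ cs.IsLeftDescent w s)) :
    cs.simple s * w = w * cs.simple t := by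
  rw [IsLeftDescent, IsLeftDescent,
    ← (cs.isReflection_simple s).inversionCocycle_eq_one_iff,
    ← (cs.isReflection_simple s).inversionCocycle_eq_one_iff, inversionCocycle_mul,
    inversionCocycle_simple] at h
  -- The cocycles of `w t` and `w` at `s` differ by that of `t` at `w⁻¹ s w`, which vanishes unless
  -- `w⁻¹ s w = t`.
  by_contra h'
  rw [Finsupp.single_eq_of_ne, add_zero] at h
  · exact h Iff.rfl
  · intro e
    apply h'
    rw [← e]; group

/-! ### Lengths of alternating words. -/

theorem leftInvSeq_alternating (ω : ℕ → B → B → List B) (h0 : ∀ s t, ω 0 s t = [])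
    (hs : ∀ k s t, ω (k + 1) s t = s :: ω k t s) (k : ℕ) (s t : B) :
    cs.leftInvSeq (ω k s t) =
      (List.range k).map fun i => (cs.simple s * cs.simple t) ^ i * cs.simple s := by
  induction k generalizing s t with
  | zero => simp [h0]
  | succ k ih =>
    rw [hs, leftInvSeq, ih, List.range_succ_eq_map, List.map_cons, List.map_map, List.map_map]
    simp only [pow_zero, one_mul, List.cons.injEq, true_and]
    refine List.map_congr_left fun i _ => ?_
    have := cs.crossingSeq_wall 1 s t (i + 1)
    rw [crossingSeq_succ, crossingSeq_wall] at this
    simpa [mul_assoc] using this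

/-- The inversion sequence consists of the `(st)^i s` with `i < k`. They are distinct because powers
of `st` below its order are, so the alternating word is reduced. -/
theorem length_altProd {s t : B} {k : ℕ}
    (hk : k ≤ orderOf (cs.simple s * cs.simple t)) :
    cs.length (altProd (cs.simple s) (cs.simple t) k) = k := by
  let ω : ℕ → B → B → List B := fun k => Nat.rec (fun _ _ => []) (fun _ f s t => s :: f t s) k
  have hω : ∀ k s t, cs.wordProd (ω k s t) = altProd (cs.simple s) (cs.simple t) k := by
    intro k
    induction k with
    | zero => intro s t; simp [ω, altProd]
    | succ k ih => intro s t; rw [altProd, ← ih]; exact cs.wordProd_cons _ _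
  have hred : cs.IsReduced (ω k s t) := by
    apply cs.isReduced_of_nodup_leftInvSeq
    have hl := cs.leftInvSeq_alternating ω (fun _ _ => rfl) (fun _ _ _ => rfl) k s t
    rw [hl]
    refine List.Nodup.map_on ?_ List.nodup_range
    intro i hi j hj hij
    rw [List.mem_range] at hi hj
    exact pow_injOn_Iio_orderOf (lt_of_lt_of_le hi hk) (lt_of_lt_of_le hj hk)
      (mul_right_cancel hij)
  have hlen := congrArg List.length (cs.leftInvSeq_alternating ω (fun _ _ => rfl)
    (fun _ _ _ => rfl) k s t)
  rw [length_leftInvSeq, List.length_map, List.length_range] at hlen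
  rw [← hω, hred.eq, hlen]

end CoxeterSystem

namespace ProPHecke

/-! ### Lengths in extended Coxeter groups -/

namespace ExtendedCoxeterGroup

variable {B W : Type*} [Group W] (E : ExtendedCoxeterGroup B W)

theorem chamber_mul (v : E.Waff) (u : E.Ω) : E.chamber ((v : W) * u) = v := by
  have h : E.compl.equiv ((v : W) * u) = (v, u) :=
    (E.compl.equiv.eq_symm_apply.1 rfl)
  rw [chamber, h]

theorem chamber_coe (v : E.Waff) : E.chamber (v : W) = v := by
  simpa using E.chamber_mul v 1

theorem exists_eq_mul (w : W) : ∃ (v : E.Waff) (u : E.Ω), w = v * u := by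
  obtain ⟨⟨v, u⟩, h⟩ := E.compl.2 w
  exact ⟨v, u, h.symm⟩

/-- Conjugation by an element of `W`, as an automorphism of `Waff`. -/
def conj (w : W) : E.Waff ≃* E.Waff :=
  letI := E.normal
  MulAut.conjNormal w

theorem coe_conj (w : W) (v : E.Waff) : (E.conj w v : W) = w * v * w⁻¹ := by
  let _ := E.normal
  exact MulAut.conjNormal_apply w v

theorem conj_coe (v v' : E.Waff) : E.conj (v : W) v' = v * v' * v⁻¹ :=
  Subtype.ext (by simp [coe_conj])

theorem conj_mul (w w' : W) (v : E.Waff) : E.conj (w * w') v = E.conj w (E.conj w' v) :=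
  Subtype.ext (by simp [coe_conj, mul_assoc])

theorem conj_omega_simple (u : E.Ω) (s : B) :
    E.conj (u : W) (E.cs.simple s) = E.cs.simple (E.act u s) :=
  Subtype.ext (by rw [coe_conj, E.conj_simple])

theorem coe_simple (s : B) : ((E.cs.simple s : E.Waff) : W) = E.simple s := rfl

theorem simple_mul_self (s : B) : E.simple s * E.simple s = 1 := by
  rw [← coe_simple, ← Subgroup.coe_mul, E.cs.simple_mul_simple_self, Subgroup.coe_one]

theorem inv_simple (s : B) : (E.simple s)⁻¹ = E.simple s :=
  inv_eq_of_mul_eq_one_right (E.simple_mul_self s)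

theorem omega_mul_simple (u : E.Ω) (s : B) :
    (u : W) * E.simple s = E.simple (E.act u s) * u := by
  rw [← coe_simple, ← coe_simple, ← E.conj_simple]; group

theorem omega_mul_coe (u : E.Ω) (v : E.Waff) : (u : W) * v = (E.conj u v : E.Waff) * u := by
  rw [coe_conj]; group

/-- Conjugation by `u` permutes the simple reflections and so carries a reduced word to a word of
equal length. Applied also to `u⁻¹`, this gives invariance of the length. -/
theorem length_conj_le (u : E.Ω) (v : E.Waff) : E.cs.length (E.conj u v) ≤ E.cs.length v := by
  obtain ⟨ω, hω, rfl⟩ := E.cs.exists_isReduced v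
  have : E.conj (u : W) (E.cs.wordProd ω) = E.cs.wordProd (ω.map (E.act u)) := by
    induction ω with
    | nil => simp
    | cons s ω ih =>
      rw [E.cs.wordProd_cons, map_mul, ih (hω.drop 1), conj_omega_simple, List.map_cons,
        E.cs.wordProd_cons]
  rw [this, hω.eq]
  exact (E.cs.length_wordProd_le _).trans (by simp)

theorem length_conj (u : E.Ω) (v : E.Waff) : E.cs.length (E.conj u v) = E.cs.length v := by
  refine le_antisymm (E.length_conj_le u v) ?_
  have := E.length_conj_le u⁻¹ (E.conj u v)
  rwa [← conj_mul, Subgroup.coe_inv, inv_mul_cancel, ← Subgroup.coe_one, conj_coe, one_mul,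
    inv_one, mul_one] at this

theorem length_coe (v : E.Waff) : E.length (v : W) = E.cs.length v := by
  rw [length, chamber_coe]

theorem length_coe_mul (v : E.Waff) (u : E.Ω) : E.length ((v : W) * u) = E.cs.length v := by
  rw [length, chamber_mul]

theorem length_mul_omega (w : W) (u : E.Ω) : E.length (w * u) = E.length w := by
  obtain ⟨v, u', rfl⟩ := E.exists_eq_mul w
  rw [mul_assoc, ← Subgroup.coe_mul, length_coe_mul, length_coe_mul]

theorem length_omega_mul (u : E.Ω) (w : W) : E.length (u * w) = E.length w := by
  obtain ⟨v, u', rfl⟩ := E.exists_eq_mul w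
  rw [← mul_assoc, omega_mul_coe, length_mul_omega, length_mul_omega, length_mul_omega,
    length_coe, length_coe, length_conj]

theorem length_omega (u : E.Ω) : E.length (u : W) = 0 := by
  have := E.length_coe_mul 1 u
  rwa [Subgroup.coe_one, one_mul, E.cs.length_one] at this

theorem length_inv (w : W) : E.length w⁻¹ = E.length w := by
  obtain ⟨v, u, rfl⟩ := E.exists_eq_mul w
  rw [mul_inv_rev, ← Subgroup.coe_inv, ← Subgroup.coe_inv, length_omega_mul, length_mul_omega,
    length_coe, length_coe, E.cs.length_inv]

theorem length_simple_mul (s : B) (w : W) :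
    E.length (E.simple s * w) = E.length w + 1 ∨ E.length (E.simple s * w) + 1 = E.length w := by
  obtain ⟨v, u, rfl⟩ := E.exists_eq_mul w
  rw [← coe_simple, ← mul_assoc, ← Subgroup.coe_mul, length_coe_mul, length_coe_mul]
  exact E.cs.length_simple_mul v s

theorem length_simple (s : B) : E.length (E.simple s) = 1 := by
  rw [← coe_simple, length_coe, E.cs.length_simple]

theorem simple_mul_eq_mul_simple {w : W} {s t : B}
    (h : ¬(E.length (E.simple s * (w * E.simple t)) < E.length (w * E.simple t) ↔
      E.length (E.simple s * w) < E.length w)) :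
    E.simple s * w = w * E.simple t := by
  obtain ⟨v, u, rfl⟩ := E.exists_eq_mul w
  have e : (v : W) * u * E.simple t = v * E.simple (E.act u t) * u := by
    rw [mul_assoc, omega_mul_simple, mul_assoc]
  rw [e] at h ⊢
  simp only [← mul_assoc, length_mul_omega] at h
  rw [← coe_simple, ← coe_simple, ← Subgroup.coe_mul, ← Subgroup.coe_mul,
    ← Subgroup.coe_mul, length_coe, length_coe, length_coe, length_coe] at h
  rw [← mul_assoc, ← coe_simple, ← coe_simple, ← Subgroup.coe_mul, ← Subgroup.coe_mul,
    E.cs.simple_mul_eq_mul_simple (by rwa [mul_assoc] at h)]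

/-- Inversion preserves lengths and simple reflections and exchanges the two sides. -/
theorem simple_mul_eq_mul_simple' {w : W} {s t : B}
    (h : ¬(E.length (E.simple s * w * E.simple t) < E.length (E.simple s * w) ↔
      E.length (w * E.simple t) < E.length w)) :
    E.simple s * w = w * E.simple t := by
  have := E.simple_mul_eq_mul_simple (w := w⁻¹) (s := t) (t := s)
  rw [← E.length_inv, ← E.length_inv (E.simple s * w), ← E.length_inv (w * E.simple t),
    ← E.length_inv w] at h
  simp only [mul_inv_rev, inv_simple] at h
  have h' := congrArg (·⁻¹) (this h)
  simpa [inv_simple] using h'.symm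

theorem coe_wordProd (l : List B) : (E.cs.wordProd l : W) = (l.map E.simple).prod := by
  induction l with
  | nil => simp
  | cons s l ih => rw [E.cs.wordProd_cons, Subgroup.coe_mul, ih, List.map_cons, List.prod_cons]; rfl

theorem isReduced_iff (l : List B) (u : E.Ω) :
    E.length ((l.map E.simple).prod * (u : W)) = l.length ↔ E.cs.IsReduced l := by
  rw [← coe_wordProd, length_coe_mul]; rfl

theorem exists_isReduced (w : W) : ∃ (l : List B) (u : E.Ω), E.cs.IsReduced l ∧
    w = (l.map E.simple).prod * u := by
  obtain ⟨v, u, rfl⟩ := E.exists_eq_mul w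
  obtain ⟨l, hl, rfl⟩ := E.cs.exists_isReduced v
  exact ⟨l, u, hl, by rw [coe_wordProd]⟩

end ExtendedCoxeterGroup

/-! ### Lengths in pro-`p` Coxeter groups. -/

namespace ProPCoxeterGroup

variable {B W W1 : Type*} [Group W] [Group W1] {E : ExtendedCoxeterGroup B W}
  (P : ProPCoxeterGroup E W1)

theorem π_T (t : P.T) : P.π t = 1 := t.2

theorem π_prod_n (l : List B) : P.π (l.map P.n).prod = (l.map E.simple).prod := by
  rw [map_list_prod, List.map_map]
  congr 2
  funext s
  exact P.π_n s

theorem length_isReduced_iff (l : List B) (u : P.Ω1) :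
    P.length ((l.map P.n).prod * (u : W1)) = l.length ↔ E.cs.IsReduced l := by
  rw [← E.isReduced_iff l ⟨P.π u, u.2⟩, length, map_mul, π_prod_n]

theorem exists_isReduced (w : W1) : ∃ (l : List B) (u : P.Ω1), E.cs.IsReduced l ∧
    w = (l.map P.n).prod * u := by
  obtain ⟨l, u, hl, h⟩ := E.exists_isReduced (P.π w)
  refine ⟨l, ⟨(l.map P.n).prod⁻¹ * w, ?_⟩, hl, by simp⟩
  rw [Ω1, Subgroup.mem_comap, map_mul, map_inv, π_prod_n, h]
  simp

theorem length_prod (l : List B) (hl : E.cs.IsReduced l) (u : P.Ω1) :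
    P.length ((l.map P.n).prod * (u : W1)) = l.length := (P.length_isReduced_iff l u).2 hl

theorem length_mul_omega (w : W1) (u : P.Ω1) : P.length (w * u) = P.length w := by
  rw [length, map_mul]; exact E.length_mul_omega _ ⟨P.π u, u.2⟩

theorem length_omega_mul (u : P.Ω1) (w : W1) : P.length (u * w) = P.length w := by
  rw [length, map_mul]; exact E.length_omega_mul ⟨P.π u, u.2⟩ _

theorem length_omega (u : P.Ω1) : P.length (u : W1) = 0 := E.length_omega ⟨P.π u, u.2⟩

theorem length_n (s : B) : P.length (P.n s) = 1 := by
  rw [length, π_n, E.length_simple]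

theorem length_one : P.length (1 : W1) = 0 := P.length_omega 1

theorem length_inv (w : W1) : P.length w⁻¹ = P.length w := by
  rw [length, map_inv, E.length_inv, length]

theorem length_n_mul (s : B) (w : W1) :
    P.length (P.n s * w) = P.length w + 1 ∨ P.length (P.n s * w) + 1 = P.length w := by
  simpa only [length, map_mul, π_n] using E.length_simple_mul s (P.π w)

theorem T_le_Ω1 : P.T ≤ P.Ω1 := fun x hx => by
  rw [Ω1, Subgroup.mem_comap, (MonoidHom.mem_ker).1 hx]
  exact one_mem _

theorem n_mul_n_mem_T (s : B) : P.n s * P.n s ∈ P.T := by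
  rw [MonoidHom.mem_ker, map_mul, π_n, E.simple_mul_self]

theorem length_mul_T (w : W1) (t : P.T) : P.length (w * t) = P.length w :=
  P.length_mul_omega w ⟨t, P.T_le_Ω1 t.2⟩

theorem length_T_mul (t : P.T) (w : W1) : P.length (t * w) = P.length w :=
  P.length_omega_mul ⟨t, P.T_le_Ω1 t.2⟩ w

theorem length_prod_mul_le (l : List B) (w : W1) :
    P.length ((l.map P.n).prod * w) ≤ l.length + P.length w := by
  induction l with
  | nil => simp
  | cons s l ih =>
    rw [List.map_cons, List.prod_cons, mul_assoc, List.length_cons]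
    have := P.length_n_mul s ((l.map P.n).prod * w)
    omega

end ProPCoxeterGroup

end ProPHecke

namespace ProPHecke

namespace ProPCoxeterGroup

variable {B W W1 : Type*} [Group W] [Group W1] {E : ExtendedCoxeterGroup B W}
  (P : ProPCoxeterGroup E W1) {R : Type*} [CommRing R] (a : B → R) (b : B → MonoidAlgebra R P.T)

/-! ### Relations in the Hecke algebra -/

theorem heckeT_one : P.heckeT a b 1 = 1 := by
  rw [heckeT, RingQuot.mkAlgHom_rel R (HeckeRel.one (P := P) (a := a) (b := b)), map_one]

variable {P} in
theorem heckeT_mul {w w' : W1} (h : P.length (w * w') = P.length w + P.length w') :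
    P.heckeT a b (w * w') = P.heckeT a b w * P.heckeT a b w' := by
  rw [heckeT, RingQuot.mkAlgHom_rel R (HeckeRel.mul (P := P) (a := a) (b := b) w w' h), map_mul]
  rfl

theorem heckeT_mul_self (s : B) : P.heckeT a b (P.n s) * P.heckeT a b (P.n s) =
    a s • P.heckeT a b (P.n s * P.n s) + P.heckeT a b (P.n s) * P.ofRT a b (b s) := by
  have h := RingQuot.mkAlgHom_rel R (HeckeRel.quad (P := P) (a := a) (b := b) s)
  rw [map_mul, map_add, map_smul, map_mul, map_finsuppSum] at h
  simpa only [map_smul, heckeT, ofRT] using h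

theorem ofRT_single (t : P.T) (r : R) :
    P.ofRT a b (MonoidAlgebra.single t r) = r • P.heckeT a b (t : W1) := by
  simp [ofRT]

theorem ofRT_add (x y : MonoidAlgebra R P.T) :
    P.ofRT a b (x + y) = P.ofRT a b x + P.ofRT a b y := by
  rw [ofRT, MonoidAlgebra.coeff_add, Finsupp.sum_add_index']
  · rfl
  · simp
  · simp [add_smul]

theorem ofRT_zero : P.ofRT a b 0 = 0 := by simp [ofRT]

theorem heckeT_T_mul (t : P.T) (w : W1) :
    P.heckeT a b (t * w) = P.heckeT a b (t : W1) * P.heckeT a b w :=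
  heckeT_mul a b (by
    rw [P.length_T_mul, P.length_omega ⟨t, P.T_le_Ω1 t.2⟩, zero_add])

theorem heckeT_mul_T (w : W1) (t : P.T) :
    P.heckeT a b (w * t) = P.heckeT a b w * P.heckeT a b (t : W1) :=
  heckeT_mul a b (by
    rw [P.length_mul_T, P.length_omega ⟨t, P.T_le_Ω1 t.2⟩, add_zero])

theorem heckeT_omega_mul (u : P.Ω1) (w : W1) :
    P.heckeT a b (u * w) = P.heckeT a b (u : W1) * P.heckeT a b w :=
  heckeT_mul a b (by rw [P.length_omega_mul, P.length_omega, zero_add])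

theorem heckeT_mul_omega (w : W1) (u : P.Ω1) :
    P.heckeT a b (w * u) = P.heckeT a b w * P.heckeT a b (u : W1) :=
  heckeT_mul a b (by rw [P.length_mul_omega, P.length_omega, add_zero])

theorem heckeT_prod {l : List B} (hl : E.cs.IsReduced l) :
    P.heckeT a b (l.map P.n).prod = (l.map fun s => P.heckeT a b (P.n s)).prod := by
  induction l with
  | nil => simp [heckeT_one]
  | cons s l ih =>
    have h := P.length_prod _ hl 1
    have h' := P.length_prod _ (hl.drop 1) 1
    simp only [Subgroup.coe_one, mul_one, List.map_cons, List.prod_cons, List.length_cons,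
      List.drop_succ_cons, List.drop_zero] at h h'
    rw [List.map_cons, List.prod_cons, heckeT_mul a b (by rw [h, h', P.length_n, add_comm]),
      ih (hl.drop 1), List.map_cons, List.prod_cons]

/-! ### The standard elements span -/

theorem heckeT_n_mul_mem_span (s : B) (w : W1) : P.heckeT a b (P.n s) * P.heckeT a b w ∈
    Submodule.span R (Set.range (P.heckeT a b)) := by
  have hT : ∀ w, P.heckeT a b w ∈ Submodule.span R (Set.range (P.heckeT a b)) :=
    fun w => Submodule.subset_span ⟨w, rfl⟩
  rcases P.length_n_mul s w with h | h
  · rw [← heckeT_mul a b (by rw [h, P.length_n, add_comm])]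
    exact hT _
  -- Here `s` shortens `w = n_s w'`, so the quadratic relation applies to `T_{n_s}² T_{w'}`.
  -- Elements of `T` do not affect lengths, hence each `T_{n_s} T_t T_{w'}` is again a standard
  -- element.
  · obtain ⟨w', rfl⟩ : ∃ w', w = P.n s * w' := ⟨(P.n s)⁻¹ * w, by simp⟩
    have h1 : P.length (P.n s * w') = P.length w' + 1 := by
      have e : P.n s * (P.n s * w') = (⟨_, P.n_mul_n_mem_T s⟩ : P.T) * w' := by simp [mul_assoc]
      rw [e, P.length_T_mul] at h
      exact h.symm
    have hup : ∀ t : P.T, P.length (P.n s * (t * w')) = P.length (P.n s) + P.length (t * w') := by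
      intro t
      have e : P.n s * (t * w') = (⟨P.n s * t * (P.n s)⁻¹, by
        simp [MonoidHom.mem_ker, P.π_T]⟩ : P.T) * (P.n s * w') := by simp [mul_assoc]
      rw [e, P.length_T_mul, P.length_T_mul, h1, P.length_n, add_comm]
    rw [heckeT_mul a b (by rw [h1, P.length_n, add_comm]), ← mul_assoc, heckeT_mul_self, add_mul]
    refine add_mem ?_ ?_
    · rw [smul_mul_assoc, ← P.heckeT_T_mul a b ⟨_, P.n_mul_n_mem_T s⟩]
      exact Submodule.smul_mem _ _ (hT _)
    · induction b s using MonoidAlgebra.induction_linear with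
      | zero => simp [ofRT_zero]
      | add x y hx hy =>
        rw [ofRT_add, mul_add, add_mul]
        exact add_mem hx hy
      | single t r =>
        rw [ofRT_single, mul_smul_comm, smul_mul_assoc, mul_assoc, ← heckeT_T_mul,
          ← heckeT_mul a b (hup t)]
        exact Submodule.smul_mem _ _ (hT _)

theorem span_heckeT : Submodule.span R (Set.range (P.heckeT a b)) = ⊤ := by
  set V := Submodule.span R (Set.range (P.heckeT a b)) with hV
  have hn : ∀ s, ∀ y ∈ V, P.heckeT a b (P.n s) * y ∈ V := fun s y hy => by
    induction hy using Submodule.span_induction with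
    | mem x hx => obtain ⟨w, rfl⟩ := hx; exact P.heckeT_n_mul_mem_span a b s w
    | zero => simp
    | add x y _ _ hx hy => rw [mul_add]; exact add_mem hx hy
    | smul r x _ hx => rw [mul_smul_comm]; exact Submodule.smul_mem _ _ hx
  have hu : ∀ u : P.Ω1, ∀ y ∈ V, P.heckeT a b (u : W1) * y ∈ V := fun u y hy => by
    induction hy using Submodule.span_induction with
    | mem x hx =>
      obtain ⟨w, rfl⟩ := hx
      rw [← heckeT_omega_mul]
      exact Submodule.subset_span ⟨_, rfl⟩
    | zero => simp
    | add x y _ _ hx hy => rw [mul_add]; exact add_mem hx hy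
    | smul r x _ hx => rw [mul_smul_comm]; exact Submodule.smul_mem _ _ hx
  have hw : ∀ w, ∀ y ∈ V, P.heckeT a b w * y ∈ V := fun w => by
    obtain ⟨l, u, hl, rfl⟩ := P.exists_isReduced w
    intro y hy
    rw [heckeT_mul_omega, P.heckeT_prod a b hl, mul_assoc]
    clear hl
    induction l with
    | nil => simpa using hu u y hy
    | cons s l ih => simpa [mul_assoc] using hn s _ ih
  rw [eq_top_iff]
  intro x _
  obtain ⟨x, rfl⟩ := RingQuot.mkAlgHom_surjective R _ x
  have key : ∀ x, ∀ y ∈ V, RingQuot.mkAlgHom R (P.HeckeRel a b) x * y ∈ V := by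
    intro x
    induction x using FreeAlgebra.induction with
    | grade0 r =>
      intro y hy
      rw [AlgHom.commutes, ← Algebra.smul_def]
      exact V.smul_mem r hy
    | grade1 w => exact hw w
    | mul x x' hx hx' =>
      intro y hy
      rw [map_mul, mul_assoc]
      exact hx _ (hx' y hy)
    | add x x' hx hx' =>
      intro y hy
      rw [map_add, add_mul]
      exact add_mem (hx y hy) (hx' y hy)
  simpa using key x 1 (by rw [← P.heckeT_one a b]; exact Submodule.subset_span ⟨1, rfl⟩)

end ProPCoxeterGroup

end ProPHecke

namespace ProPHecke

namespace ProPCoxeterGroup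

variable {B W W1 : Type*} [Group W] [Group W1] {E : ExtendedCoxeterGroup B W}
  (P : ProPCoxeterGroup E W1) {R : Type*} [CommRing R] (a : B → R) (b : B → MonoidAlgebra R P.T)

/-! ### The regular representation of the Hecke algebra -/

/-- The inclusion of `R[T]` into `R[W1]`. -/
noncomputable def inclT (R : Type*) [CommRing R] : MonoidAlgebra R P.T →ₐ[R] MonoidAlgebra R W1 :=
  MonoidAlgebra.mapDomainAlgHom R R P.T.subtype

theorem inclT_single (t : P.T) (r : R) :
    P.inclT R (MonoidAlgebra.single t r) = r • MonoidAlgebra.of R W1 t := by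
  simp [inclT]

local notation "δ" => MonoidAlgebra.of R W1

theorem inclT_mapDomain_conj (w : W1) (x : MonoidAlgebra R P.T) :
    P.inclT R (MonoidAlgebra.mapDomain (fun x : P.T => MulAut.conjNormal w x) x) =
      δ w * P.inclT R x * δ w⁻¹ := by
  induction x using MonoidAlgebra.induction_linear with
  | zero => simp
  | add x y hx hy => rw [MonoidAlgebra.mapDomain_add, map_add, hx, hy, map_add, mul_add, add_mul]
  | single t r =>
    rw [MonoidAlgebra.mapDomain_single, inclT_single, inclT_single, mul_smul_comm, smul_mul_assoc,
      ← map_mul, ← map_mul, MulAut.conjNormal_apply]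

variable {a b} {P}

theorem IsParameter.a_eq (hab : P.IsParameter a b) {s t : B} {w : W1}
    (h : E.simple s * P.π w = P.π w * E.simple t) : a s = a t := (hab s t w h).1

/-- The condition on `b`, read in `R[W1]`, says `b_s w n_t = n_s w n_t⁻¹ b_t n_t`, and `n_t`
commutes with `b_t`. This identity matches the correction terms of left and right multiplication. -/
theorem IsParameter.inclT_mul (hab : P.IsParameter a b) {s t : B} {w : W1}
    (h : E.simple s * P.π w = P.π w * E.simple t) :
    P.inclT R (b s) * δ w * δ (P.n t) = δ (P.n s) * δ w * P.inclT R (b t) := by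
  -- The parameter condition for `s = t`, `w = n_t`, where the element of `T` is `1`.
  have hcomm : δ (P.n t) * P.inclT R (b t) = P.inclT R (b t) * δ (P.n t) := by
    have h1 := congrArg (P.inclT R) (hab t t (P.n t) (by rw [P.π_n])).2
    rw [map_mul, inclT_single, inclT_mapDomain_conj, one_smul] at h1
    simp only [mul_inv_cancel_right, mul_inv_cancel, map_one, one_mul] at h1
    conv_rhs => rw [← h1]
    rw [mul_assoc, ← map_mul, inv_mul_cancel, map_one, mul_one]
  have h1 := congrArg (P.inclT R) (hab s t w h).2
  rw [map_mul, inclT_single, inclT_mapDomain_conj, one_smul] at h1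
  rw [← h1]
  simp only [← mul_assoc, ← map_mul]
  rw [mul_assoc _ (δ w⁻¹), ← map_mul, mul_assoc _ (δ (w⁻¹ * w)), ← map_mul]
  simp only [inv_mul_cancel, one_mul, inv_mul_cancel_right]
  rw [mul_assoc, ← hcomm, ← mul_assoc, ← map_mul, inv_mul_cancel_right]

variable (a b) (P)

open scoped Classical in
/-- The element by which `T_{n_s}` multiplies `T_w`, depending on whether `s` decreases the length
of `w`. -/
noncomputable def factor (s : B) (p : Prop) : MonoidAlgebra R W1 :=
  if p then a s • δ (P.n s) + P.inclT R (b s) else δ (P.n s)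

/-- Left multiplication by `T_{n_s}` in the model `R[W1]` of the Hecke algebra. -/
noncomputable def leftOp (s : B) : Module.End R (MonoidAlgebra R W1) :=
  (MonoidAlgebra.basis W1 R).constr R fun w =>
    P.factor a b s (P.length (P.n s * w) < P.length w) * δ w

/-- Right multiplication by `T_{n_s}` in the model `R[W1]` of the Hecke algebra. -/
noncomputable def rightOp (s : B) : Module.End R (MonoidAlgebra R W1) :=
  (MonoidAlgebra.basis W1 R).constr R fun w =>
    δ w * P.factor a b s (P.length (w * P.n s) < P.length w)

theorem leftOp_of (s : B) (w : W1) : P.leftOp a b s (δ w) =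
    P.factor a b s (P.length (P.n s * w) < P.length w) * δ w := by
  have := (MonoidAlgebra.basis W1 R).constr_basis R (fun w =>
    P.factor a b s (P.length (P.n s * w) < P.length w) * δ w) w
  simpa [leftOp] using this

theorem rightOp_of (s : B) (w : W1) : P.rightOp a b s (δ w) =
    δ w * P.factor a b s (P.length (w * P.n s) < P.length w) := by
  have := (MonoidAlgebra.basis W1 R).constr_basis R (fun w =>
    δ w * P.factor a b s (P.length (w * P.n s) < P.length w)) w
  simpa [rightOp] using this

theorem leftOp_of_mul_inclT (s : B) (w : W1) (x : MonoidAlgebra R P.T) :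
    P.leftOp a b s (δ w * P.inclT R x) =
      P.factor a b s (P.length (P.n s * w) < P.length w) * δ w * P.inclT R x := by
  induction x using MonoidAlgebra.induction_linear with
  | zero => simp
  | add x y hx hy => rw [map_add, mul_add, map_add, hx, hy, mul_add]
  | single t r =>
    rw [inclT_single, mul_smul_comm, mul_smul_comm, ← map_mul, map_smul, leftOp_of, ← mul_assoc,
      P.length_mul_T, P.length_mul_T, map_mul, mul_assoc]

theorem rightOp_inclT_mul_of (s : B) (w : W1) (x : MonoidAlgebra R P.T) :
    P.rightOp a b s (P.inclT R x * δ w) =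
      P.inclT R x * δ w * P.factor a b s (P.length (w * P.n s) < P.length w) := by
  induction x using MonoidAlgebra.induction_linear with
  | zero => simp
  | add x y hx hy => rw [map_add, add_mul, map_add, hx, hy, add_mul]
  | single t r =>
    rw [inclT_single, smul_mul_assoc, smul_mul_assoc, ← map_mul, map_smul, rightOp_of, mul_assoc,
      P.length_T_mul, P.length_T_mul]

theorem linearMap_ext {f g : Module.End R (MonoidAlgebra R W1)} (h : ∀ w, f (δ w) = g (δ w)) :
    f = g :=
  (MonoidAlgebra.basis W1 R).ext fun w => by simpa using h w

variable {P a b}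

/-- Unless `s w = w t`, multiplying by `t` on the right does not change whether `s` shortens, and
conversely, so the two factors act independently. If `s w = w t`, the descents are flipped together,
and the two results agree by `a_s = a_t` and `IsParameter.inclT_mul`. -/
theorem IsParameter.leftOp_comm_rightOp (hab : P.IsParameter a b) (s t : B) :
    P.rightOp a b t * P.leftOp a b s = P.leftOp a b s * P.rightOp a b t := by
  apply linearMap_ext
  intro w
  rw [Module.End.mul_apply, Module.End.mul_apply, leftOp_of, rightOp_of]
  set p := P.length (P.n s * w) < P.length w with hp
  set q := P.length (w * P.n t) < P.length w with hq
  set p' := P.length (P.n s * (w * P.n t)) < P.length (w * P.n t) with hp'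
  set q' := P.length (P.n s * w * P.n t) < P.length (P.n s * w) with hq'
  have hL : P.leftOp a b s (δ w * P.factor a b t q) = if q then
      a t • (P.factor a b s p' * (δ w * δ (P.n t))) + P.factor a b s p * δ w * P.inclT R (b t)
      else P.factor a b s p' * (δ w * δ (P.n t)) := by
    by_cases h : q
    · rw [factor, if_pos h, if_pos h, mul_add, mul_smul_comm, map_add, map_smul,
        leftOp_of_mul_inclT, ← map_mul, leftOp_of]
    · rw [factor, if_neg h, if_neg h, ← map_mul, leftOp_of]
  have hR : P.rightOp a b t (P.factor a b s p * δ w) = if p then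
      a s • (δ (P.n s) * δ w * P.factor a b t q') + P.inclT R (b s) * δ w * P.factor a b t q
      else δ (P.n s) * δ w * P.factor a b t q' := by
    by_cases h : p
    · rw [factor, if_pos h, if_pos h, add_mul, smul_mul_assoc, map_add, map_smul,
        rightOp_inclT_mul_of, ← map_mul, rightOp_of]
    · rw [factor, if_neg h, if_neg h, ← map_mul, rightOp_of]
  rw [hL, hR]
  by_cases hst : E.simple s * P.π w = P.π w * E.simple t
  · have h1 : P.length (P.n s * w) = P.length (w * P.n t) := by
      simp only [length, map_mul, π_n, hst]
    have h2 : P.length (P.n s * (w * P.n t)) = P.length w := by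
      simp only [length, map_mul, π_n]
      rw [← mul_assoc, hst, mul_assoc, E.simple_mul_self, mul_one]
    have hne := P.length_n_mul s w
    have hpq : q ↔ p := by rw [hp, hq, h1]
    have hpp : p' ↔ ¬ p := by rw [hp, hp', h2, ← h1]; omega
    have hqq : q' ↔ ¬ p := by rw [hp, hq', mul_assoc, h2]; omega
    have key := hab.inclT_mul hst
    have ha := hab.a_eq hst
    by_cases h : p
    · simp only [hpq, hpp, hqq, factor, h, if_true, if_false, not_true_eq_false]
      simp only [mul_add, add_mul, mul_smul_comm, smul_mul_assoc, ← mul_assoc, key, ha]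
    · simp only [hpq, hpp, hqq, factor, h, if_true, if_false, not_false_eq_true]
      simp only [mul_add, add_mul, mul_smul_comm, smul_mul_assoc, ← mul_assoc, key, ha]
  · have hpp : p' ↔ p := by
      by_contra h
      apply hst
      apply E.simple_mul_eq_mul_simple
      simpa only [hp, hp', length, map_mul, π_n] using h
    have hqq : q' ↔ q := by
      by_contra h
      apply hst
      apply E.simple_mul_eq_mul_simple'
      simpa only [hq, hq', length, map_mul, π_n] using h
    by_cases h : p <;> by_cases h' : q <;>
      simp only [hpp, hqq, factor, h, h', if_true, if_false, mul_add, add_mul, mul_smul_comm,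
        smul_mul_assoc, ← mul_assoc, smul_add]
    rw [smul_comm (a s)]
    abel

variable (P a b)

theorem leftOp_comm_mulRight (s : B) (u : P.Ω1) :
    LinearMap.mulRight R (δ (u : W1)) * P.leftOp a b s =
      P.leftOp a b s * LinearMap.mulRight R (δ (u : W1)) := by
  apply linearMap_ext
  intro w
  rw [Module.End.mul_apply, Module.End.mul_apply, LinearMap.mulRight_apply,
    LinearMap.mulRight_apply, ← map_mul, leftOp_of, leftOp_of, ← mul_assoc, P.length_mul_omega,
    P.length_mul_omega, map_mul, mul_assoc]

theorem rightOp_comm_mulLeft (s : B) (u : P.Ω1) :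
    P.rightOp a b s * LinearMap.mulLeft R (δ (u : W1)) =
      LinearMap.mulLeft R (δ (u : W1)) * P.rightOp a b s := by
  apply linearMap_ext
  intro w
  rw [Module.End.mul_apply, Module.End.mul_apply, LinearMap.mulLeft_apply,
    LinearMap.mulLeft_apply, ← map_mul, rightOp_of, rightOp_of, mul_assoc, P.length_omega_mul,
    P.length_omega_mul, map_mul, mul_assoc]

/-! ### The commutant of the right operators and linear independence. -/

/-- The endomorphisms of the model `R[W1]` that commute with the right multiplications. -/
noncomputable def rightCommutant : Subalgebra R (Module.End R (MonoidAlgebra R W1)) :=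
  Subalgebra.centralizer R (Set.range (P.rightOp a b) ∪
    Set.range fun u : P.Ω1 => LinearMap.mulRight R (δ (u : W1)))

/-- A reduced expression of `w` produces the basis vector `w` from `1` by right operators, none of
which meets a descent. Commuting maps that agree at `1` therefore agree everywhere. -/
theorem ext_rightCommutant {f g : Module.End R (MonoidAlgebra R W1)}
    (hf : f ∈ P.rightCommutant a b) (hg : g ∈ P.rightCommutant a b) (h : f 1 = g 1) : f = g := by
  apply linearMap_ext
  intro w
  obtain ⟨l, u, hl, rfl⟩ := P.exists_isReduced w
  have h1 : f (δ (l.map P.n).prod) = g (δ (l.map P.n).prod) := by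
    induction l using List.reverseRecOn with
    | nil => simpa only [List.map_nil, List.prod_nil, map_one] using h
    | append_singleton l s ih =>
      have hl' : E.cs.IsReduced l := by simpa using hl.take l.length
      have hlen := P.length_prod _ hl 1
      have hlen' := P.length_prod _ hl' 1
      simp only [Subgroup.coe_one, mul_one, List.length_append, List.length_singleton] at hlen hlen'
      have e : ((l ++ [s]).map P.n).prod = (l.map P.n).prod * P.n s := by simp
      have e' : δ ((l ++ [s]).map P.n).prod = P.rightOp a b s (δ (l.map P.n).prod) := by
        rw [rightOp_of, factor, if_neg, ← map_mul, e]
        rw [← e, hlen, hlen']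
        omega
      rw [e', ← Module.End.mul_apply, ← Module.End.mul_apply, ← hf _ (Or.inl ⟨s, rfl⟩),
        ← hg _ (Or.inl ⟨s, rfl⟩), Module.End.mul_apply, Module.End.mul_apply, ih hl']
  have e : δ ((l.map P.n).prod * u) = LinearMap.mulRight R (δ (u : W1)) (δ (l.map P.n).prod) := by
    rw [LinearMap.mulRight_apply, map_mul]
  rw [e, ← Module.End.mul_apply, ← Module.End.mul_apply, ← hf _ (Or.inr ⟨u, rfl⟩),
    ← hg _ (Or.inr ⟨u, rfl⟩), Module.End.mul_apply, Module.End.mul_apply, h1]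

theorem prod_leftOp_of (l : List B) (w : W1)
    (h : P.length ((l.map P.n).prod * w) = l.length + P.length w) :
    (l.map (P.leftOp a b)).prod (δ w) = δ ((l.map P.n).prod * w) := by
  induction l with
  | nil => simp
  | cons s l ih =>
    rw [List.map_cons, List.prod_cons, mul_assoc, List.length_cons] at h
    have h1 := P.length_n_mul s ((l.map P.n).prod * w)
    have h2 := P.length_prod_mul_le l w
    rw [List.map_cons, List.prod_cons, Module.End.mul_apply, ih (by omega), leftOp_of, factor,
      if_neg (by omega), List.map_cons, List.prod_cons, ← map_mul, mul_assoc]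

variable {P a b}

/-- The operator is the product of left operators along a reduced expression of `w`. By
`ext_rightCommutant` it does not depend on the expression, so no braid relation has to be checked.
-/
theorem IsParameter.exists_mem_rightCommutant (hab : P.IsParameter a b) (w : W1) :
    ∃ f ∈ P.rightCommutant a b, f 1 = δ w ∧
      ∀ w', P.length (w * w') = P.length w + P.length w' → f (δ w') = δ (w * w') := by
  obtain ⟨l, u, hl, rfl⟩ := P.exists_isReduced w
  have key : ∀ w', P.length ((l.map P.n).prod * u * w') = P.length ((l.map P.n).prod * u) +
      P.length w' → ((l.map (P.leftOp a b)).prod * LinearMap.mulLeft R (δ (u : W1))) (δ w') =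
        δ ((l.map P.n).prod * u * w') := by
    intro w' h
    rw [Module.End.mul_apply, LinearMap.mulLeft_apply, ← map_mul, prod_leftOp_of, mul_assoc]
    rw [← mul_assoc, h, P.length_prod l hl, P.length_omega_mul]
  refine ⟨(l.map (P.leftOp a b)).prod * LinearMap.mulLeft R (δ (u : W1)), ?_, ?_, key⟩
  · refine mul_mem (list_prod_mem fun f hf => ?_) ?_
    · obtain ⟨s, _, rfl⟩ := List.mem_map.1 hf
      rintro _ (⟨t, rfl⟩ | ⟨u, rfl⟩)
      · exact hab.leftOp_comm_rightOp s t
      · exact P.leftOp_comm_mulRight a b s u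
    · rintro _ (⟨t, rfl⟩ | ⟨u', rfl⟩)
      · exact P.rightOp_comm_mulLeft a b t u
      · apply linearMap_ext
        intro w
        simp only [Module.End.mul_apply, LinearMap.mulLeft_apply, LinearMap.mulRight_apply,
          mul_assoc]
  · have := key 1 (by rw [mul_one, P.length_one, add_zero])
    rwa [map_one, mul_one] at this

/-- Both sides of each defining relation lie in the commutant, so it suffices to compare their
values at `1`. -/
theorem IsParameter.exists_regularRep (hab : P.IsParameter a b) :
    ∃ Φ : P.HeckeAlgebra a b →ₐ[R] Module.End R (MonoidAlgebra R W1),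
      ∀ w, Φ (P.heckeT a b w) 1 = δ w := by
  choose lam hmem h1 hmul using hab.exists_mem_rightCommutant
  have hn : ∀ s, lam (P.n s) = P.leftOp a b s := fun s => by
    refine P.ext_rightCommutant a b (hmem _) ?_ ?_
    · rintro _ (⟨t, rfl⟩ | ⟨u, rfl⟩)
      · exact hab.leftOp_comm_rightOp s t
      · exact P.leftOp_comm_mulRight a b s u
    · rw [h1, ← map_one δ, leftOp_of, factor, if_neg, map_one, mul_one]
      rw [mul_one, P.length_n, P.length_one]
      omega
  have hsum : ∀ x : MonoidAlgebra R P.T, (x.coeff.sum fun t r => r • lam (t : W1)) 1 =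
      P.inclT R x := fun x => by
    induction x using MonoidAlgebra.induction_linear with
    | zero => simp
    | add x y hx hy =>
      rw [MonoidAlgebra.coeff_add, Finsupp.sum_add_index', LinearMap.add_apply, hx, hy, map_add]
      · simp
      · simp [add_smul]
    | single t r => rw [inclT_single]; simp [h1]
  have hrel : ∀ ⦃x y⦄, P.HeckeRel a b x y → FreeAlgebra.lift R lam x = FreeAlgebra.lift R lam y := by
    intro x y hxy
    cases hxy with
    | one =>
      rw [FreeAlgebra.lift_ι_apply, map_one]
      exact P.ext_rightCommutant a b (hmem _) (one_mem _) (by rw [h1, map_one]; rfl)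
    | mul w w' h =>
      rw [map_mul, FreeAlgebra.lift_ι_apply, FreeAlgebra.lift_ι_apply, FreeAlgebra.lift_ι_apply]
      refine P.ext_rightCommutant a b (hmem _) (mul_mem (hmem _) (hmem _)) ?_
      rw [h1, Module.End.mul_apply, h1, hmul _ _ h]
    | quad s =>
      simp only [map_mul, map_add, map_smul, map_finsuppSum, FreeAlgebra.lift_ι_apply]
      refine P.ext_rightCommutant a b (mul_mem (hmem _) (hmem _)) (add_mem
        (Subalgebra.smul_mem _ (hmem _) _) (mul_mem (hmem _)
          (sum_mem fun t _ => Subalgebra.smul_mem _ (hmem _) _))) ?_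
      rw [Module.End.mul_apply, LinearMap.add_apply, LinearMap.smul_apply, Module.End.mul_apply,
        hsum, h1, h1, hn, leftOp_of, factor, if_pos]
      · have h2 := P.leftOp_of_mul_inclT a b s 1 (b s)
        rw [map_one, one_mul, mul_one, mul_one, factor, if_neg] at h2
        · have h3 := hab.inclT_mul (s := s) (t := s) (w := 1) (by simp)
          rw [map_one, mul_one, mul_one] at h3
          rw [h2, add_mul, h3, smul_mul_assoc, map_mul]
        · rw [P.length_n, P.length_one]; omega
      · rw [P.length_n, length, (MonoidHom.mem_ker).1 (P.n_mul_n_mem_T s)]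
        have := P.length_one
        rw [length, map_one] at this
        omega
  refine ⟨RingQuot.liftAlgHom R ⟨FreeAlgebra.lift R lam, hrel⟩, fun w => ?_⟩
  rw [heckeT, RingQuot.liftAlgHom_mkAlgHom_apply, FreeAlgebra.lift_ι_apply, h1]

theorem IsParameter.linearIndependent_heckeT (hab : P.IsParameter a b) :
    LinearIndependent R (P.heckeT a b) := by
  obtain ⟨Φ, hΦ⟩ := hab.exists_regularRep
  refine LinearIndependent.of_comp ((LinearMap.applyₗ (1 : MonoidAlgebra R W1)).comp Φ.toLinearMap) ?_
  convert (MonoidAlgebra.basis W1 R).linearIndependent using 1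
  funext w
  simpa using hΦ w

end ProPCoxeterGroup

end ProPHecke

namespace ProPHecke

namespace ProPCoxeterGroup

variable {B W W1 : Type*} [Group W] [Group W1] {E : ExtendedCoxeterGroup B W}
  (P : ProPCoxeterGroup E W1)

/-! ### Homomorphisms out of a pro-`p` Coxeter group -/

/-- In the quotient of the normalizer by `J` the `g s` become involutions satisfying the braid
relations, so the Coxeter group maps to it. -/
theorem prod_mem_of_wordProd_eq_one {G : Type*} [Group G] (J : Subgroup G) (g : B → G)
    (hnorm : ∀ s, g s ∈ (Subgroup.normalizer (J : Set G))) (hsq : ∀ s, g s * g s ∈ J)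
    (hbraid : ∀ s t, E.m s t ≠ 0 →
      altProd (g s) (g t) (E.m s t) = altProd (g t) (g s) (E.m s t))
    {l : List B} (hl : E.cs.wordProd l = 1) : (l.map g).prod ∈ J := by
  let q := QuotientGroup.mk' (J.subgroupOf (Subgroup.normalizer (J : Set G)))
  let f : B → (Subgroup.normalizer (J : Set G)) ⧸ J.subgroupOf (Subgroup.normalizer (J : Set G)) := fun s => q ⟨g s, hnorm s⟩
  have hf : E.M.IsLiftable f := by
    apply E.cs.isLiftable_of_altProd_eq
    · intro s
      rw [← map_mul]
      exact (QuotientGroup.eq_one_iff _).2 (hsq s)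
    · intro s t hst
      rw [← ExtendedCoxeterGroup.map_altProd, ← ExtendedCoxeterGroup.map_altProd]
      congr 1
      apply Subtype.ext
      have := hbraid s t hst
      rw [← Subgroup.subtype_apply, ← Subgroup.subtype_apply,
        ExtendedCoxeterGroup.map_altProd, ExtendedCoxeterGroup.map_altProd]
      exact this
  have key : ∀ l : List B, ∃ x : (Subgroup.normalizer (J : Set G)), (x : G) = (l.map g).prod ∧
      E.cs.lift ⟨f, hf⟩ (E.cs.wordProd l) = q x := by
    intro l
    induction l with
    | nil => exact ⟨1, by simp, by simp⟩
    | cons s l ih =>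
      obtain ⟨x, hx, hx'⟩ := ih
      refine ⟨⟨g s, hnorm s⟩ * x, by simp [hx], ?_⟩
      rw [E.cs.wordProd_cons, map_mul, hx', E.cs.lift_apply_simple, map_mul]
  obtain ⟨x, hx, hx'⟩ := key l
  rw [hl, map_one] at hx'
  rw [← hx]
  exact (QuotientGroup.eq_one_iff x).1 hx'.symm

/-- Existence of homomorphisms out of `W1`, by generators and relations. -/
theorem exists_hom {G : Type*} [Group G] (p : G →* W1) (g : B → G) (j : P.Ω1 →* G)
    (hg : ∀ s, p (g s) = P.n s) (hj : ∀ u, p (j u) = u)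
    (hsq : ∀ s, g s * g s = j ⟨_, P.T_le_Ω1 (P.n_mul_n_mem_T s)⟩)
    (hcomm : ∀ s t (u u' : P.Ω1), (u : W1) * P.n s = P.n t * u' → j u * g s = g t * j u')
    (hbraid : ∀ s t, E.m s t ≠ 0 →
      altProd (g s) (g t) (E.m s t) = altProd (g t) (g s) (E.m s t)) :
    ∃ σ : W1 →* G, (∀ w, p (σ w) = w) ∧ (∀ s, σ (P.n s) = g s) ∧ ∀ u : P.Ω1, σ u = j u := by
  -- `J` is the copy of `T` in `G`. Modulo `J` the `g s` satisfy the Coxeter relations.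
  let J : Subgroup G := (P.T.subgroupOf P.Ω1).map j
  have hmemJ : ∀ x (hx : x ∈ P.T), j ⟨x, P.T_le_Ω1 hx⟩ ∈ J := fun x hx => ⟨_, hx, rfl⟩
  have hconj : ∀ s (x : P.T), g s * j ⟨x, P.T_le_Ω1 x.2⟩ * (g s)⁻¹ ∈ J := fun s x => by
    have hx : P.n s * x * (P.n s)⁻¹ ∈ P.T := by simp [MonoidHom.mem_ker, P.π_T]
    rw [← hcomm s s ⟨_, P.T_le_Ω1 hx⟩ ⟨x, P.T_le_Ω1 x.2⟩ (by simp), mul_inv_cancel_right]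
    exact hmemJ _ hx
  have hconj' : ∀ s, ∀ x ∈ J, g s * x * (g s)⁻¹ ∈ J := by
    rintro s _ ⟨x, hx, rfl⟩
    exact hconj s ⟨x, hx⟩
  have hnorm : ∀ s, g s ∈ (Subgroup.normalizer (J : Set G)) := fun s => by
    rw [Subgroup.mem_normalizer_iff]
    refine fun x => ⟨hconj' s x, fun h => ?_⟩
    have h2 : g s * g s ∈ J := by rw [hsq]; exact hmemJ _ (P.n_mul_n_mem_T s)
    have h3 := J.mul_mem (J.mul_mem (J.inv_mem h2) (hconj' s _ h)) h2
    rwa [show (g s * g s)⁻¹ * (g s * (g s * x * (g s)⁻¹) * (g s)⁻¹) * (g s * g s) = x by group]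
      at h3
  -- The map `p` restricts to an isomorphism from `K` onto `W1`; its inverse is `σ`.
  let K : Subgroup G := Subgroup.closure (Set.range g ∪ Set.range j)
  have hform : ∀ k ∈ K, ∃ (l : List B) (u : P.Ω1), k = (l.map g).prod * j u := by
    have hmul : ∀ s k, (∃ (l : List B) (u : P.Ω1), k = (l.map g).prod * j u) →
        ∃ (l : List B) (u : P.Ω1), g s * k = (l.map g).prod * j u := by
      rintro s _ ⟨l, u, rfl⟩
      exact ⟨s :: l, u, by simp [mul_assoc]⟩
    have hmulj : ∀ (v : P.Ω1) k, (∃ (l : List B) (u : P.Ω1), k = (l.map g).prod * j u) →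
        ∃ (l : List B) (u : P.Ω1), j v * k = (l.map g).prod * j u := by
      rintro v _ ⟨l, u, rfl⟩
      induction l generalizing v with
      | nil => exact ⟨[], v * u, by simp⟩
      | cons s l ih =>
        -- The letter for which `v n_s = n_t v'` with `v'` again over `Ω`; thus `j v` moves to the
        -- right through a word.
        let t := E.act ⟨P.π v, v.2⟩ s
        have hv' : (P.n t)⁻¹ * v * P.n s ∈ P.Ω1 := by
          change P.π _ ∈ E.Ω
          rw [map_mul, map_mul, map_inv, π_n, π_n, mul_assoc,
            E.omega_mul_simple ⟨P.π v, v.2⟩ s, inv_mul_cancel_left]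
          exact v.2
        have hc := hcomm s t v ⟨_, hv'⟩ (by simp [mul_assoc])
        obtain ⟨l', u', h'⟩ := ih ⟨_, hv'⟩
        refine ⟨t :: l', u', ?_⟩
        rw [List.map_cons, List.prod_cons, mul_assoc (g s), ← mul_assoc, hc, mul_assoc, h',
          List.map_cons, List.prod_cons, mul_assoc]
    intro k hk
    induction hk using Subgroup.closure_induction_left with
    | one => exact ⟨[], 1, by simp⟩
    | mul_left x hx y _ ih =>
      rcases hx with ⟨s, rfl⟩ | ⟨v, rfl⟩
      · exact hmul s y ih
      · exact hmulj v y ih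
    | inv_mul_cancel x hx y _ ih =>
      rcases hx with ⟨s, rfl⟩ | ⟨v, rfl⟩
      · have : (g s)⁻¹ * y = j (⟨_, P.T_le_Ω1 (P.n_mul_n_mem_T s)⟩)⁻¹ * (g s * y) := by
          rw [map_inv, ← hsq]; group
        rw [this]
        exact hmulj _ _ (hmul s y ih)
      · rw [← map_inv]
        exact hmulj _ y ih
  have hprod : ∀ l : List B, p (l.map g).prod = (l.map P.n).prod := fun l => by
    rw [map_list_prod, List.map_map]
    congr 2
    funext s
    exact hg s
  -- If `k = g_{s_1} ⋯ g_{s_r} j(u)` maps to `1`, the word is trivial in `Waff`, so its product is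
  -- `j x` with `x` in `T`. Then `k = j (x u)` and `x u = 1`.
  have hinj : ∀ k ∈ K, p k = 1 → k = 1 := by
    intro k hk hk1
    obtain ⟨l, u, rfl⟩ := hform k hk
    rw [map_mul, hprod, hj] at hk1
    have h1 := congrArg P.π hk1
    rw [map_mul, π_prod_n, map_one, ← E.coe_wordProd] at h1
    have h2 := congrArg E.chamber h1
    rw [E.chamber_mul _ ⟨P.π u, u.2⟩, ← Subgroup.coe_one, E.chamber_coe] at h2
    obtain ⟨x, hx, hx'⟩ := prod_mem_of_wordProd_eq_one J g hnorm
      (fun s => by rw [hsq]; exact hmemJ _ (P.n_mul_n_mem_T s)) hbraid h2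
    rw [← hx', ← map_mul]
    rw [← hprod, ← hx', hj, ← Subgroup.coe_mul] at hk1
    rw [show x * u = 1 from Subtype.ext hk1, map_one]
  have hsurj : ∀ w, ∃ k : K, p k = w := fun w => by
    obtain ⟨l, u, -, rfl⟩ := P.exists_isReduced w
    refine ⟨⟨(l.map g).prod * j u, K.mul_mem (K.list_prod_mem fun x hx => ?_)
      (Subgroup.subset_closure (Or.inr ⟨u, rfl⟩))⟩, by rw [map_mul, hprod, hj]⟩
    obtain ⟨s, _, rfl⟩ := List.mem_map.1 hx
    exact Subgroup.subset_closure (Or.inl ⟨s, rfl⟩)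
  let e : K ≃* W1 := MulEquiv.ofBijective (p.comp K.subtype)
    ⟨(injective_iff_map_eq_one _).2 fun k hk => Subtype.ext (hinj k k.2 hk), hsurj⟩
  have he : ∀ k (hk : k ∈ K), ((e.symm (p k) : K) : G) = k := fun k hk =>
    congrArg Subtype.val (e.symm_apply_apply ⟨k, hk⟩)
  refine ⟨K.subtype.comp e.symm.toMonoidHom, fun w => e.apply_symm_apply w, fun s => ?_,
    fun u => ?_⟩
  · rw [← hg]
    exact he _ (Subgroup.subset_closure (Or.inl ⟨s, rfl⟩))
  · rw [← hj]
    exact he _ (Subgroup.subset_closure (Or.inr ⟨u, rfl⟩))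

end ProPCoxeterGroup

end ProPHecke

namespace ProPHecke

/-! ### Orientations of extended Coxeter groups. -/

namespace ExtendedCoxeterGroup

variable {B W : Type*} [Group W] {E : ExtendedCoxeterGroup B W}

theorem m_comm (s t : B) : E.m s t = E.m t s := by
  rw [m, m, ← orderOf_inv]
  simp

namespace Orientation

theorem apply_mul_simple (o : E.Orientation) (w : W) (s : B) :
    o.1 (w * E.simple s) s = - o.1 w s := by
  obtain ⟨f, hf, ho⟩ := o.2
  obtain ⟨v, u, rfl⟩ := E.exists_eq_mul w
  rw [mul_assoc, omega_mul_simple, ← mul_assoc, ← coe_simple, ← Subgroup.coe_mul, ho, ho, hf.neg]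

theorem apply_mul_omega (o : E.Orientation) (w : W) (u : E.Ω) (s : B) :
    o.1 (w * u) s = o.1 w (E.act u s) := by
  obtain ⟨f, hf, ho⟩ := o.2
  obtain ⟨v, u', rfl⟩ := E.exists_eq_mul w
  rw [mul_assoc, ← Subgroup.coe_mul, ho, ho, map_mul, Equiv.Perm.mul_apply]

theorem exists_coxeterOrientation (o : E.Orientation) :
    ∃ f, E.IsCoxeterOrientation f ∧ ∀ (v : E.Waff) (s : B), o.1 v s = f v s := by
  obtain ⟨f, hf, ho⟩ := o.2
  exact ⟨f, hf, fun v s => by simpa using ho v 1 s⟩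

theorem act_apply (o : E.Orientation) (w w' : W) (s : B) : (o.act w).1 w' s = o.1 (w * w') s := rfl

theorem act_one (o : E.Orientation) : o.act 1 = o :=
  Subtype.ext (funext fun w => by simp [act])

theorem act_mul (o : E.Orientation) (w w' : W) : o.act (w * w') = (o.act w).act w' :=
  Subtype.ext (funext fun w => by simp [act, mul_assoc])

/-- Two labels of the same reflection have `m = 1`, and the dihedral axiom for one-term sequences
forces equal signs. -/
theorem apply_congr_simple (o : E.Orientation) (w : W) {s t : B} (h : E.simple s = E.simple t) :
    o.1 w s = o.1 w t := by
  obtain ⟨v, u, rfl⟩ := E.exists_eq_mul w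
  rw [apply_mul_omega, apply_mul_omega]
  obtain ⟨f, hf, ho⟩ := o.exists_coxeterOrientation
  rw [ho, ho]
  set s' := E.act u s
  set t' := E.act u t
  have hst : E.cs.simple s' = E.cs.simple t' := by
    rw [← conj_omega_simple, ← conj_omega_simple]
    congr 1
    exact Subtype.ext h
  have hm : E.m s' t' = 1 := by
    rw [m, hst, E.cs.simple_mul_simple_self, orderOf_one]
  obtain ⟨k, hk, ε, h1, h2⟩ := hf.dihedral s' t' (by rw [hm]; exact one_ne_zero) v
  rw [hm] at hk h1 h2
  have h1 := h1 0 one_pos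
  have h2 := h2 0 one_pos
  simp only [signSeq, altProd, mul_one, Even.zero, if_true] at h1 h2
  rw [h1, h2]
  interval_cases k <;> simp

end Orientation

end ExtendedCoxeterGroup

namespace ProPCoxeterGroup

variable {B W W1 : Type*} [Group W] [Group W1] {E : ExtendedCoxeterGroup B W}
  (P : ProPCoxeterGroup E W1)

/-! ### The unnormalized Bernstein maps -/

variable {P} in
theorem braidT_mul {w w' : W1} (h : P.length (w * w') = P.length w + P.length w') :
    P.braidT (w * w') = P.braidT w * P.braidT w' := by
  have := PresentedGroup.one_of_mem (rels := {r : FreeGroup W1 | ∃ w w' : W1,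
    P.length (w * w') = P.length w + P.length w' ∧
      r = FreeGroup.of (w * w') * (FreeGroup.of w * FreeGroup.of w')⁻¹}) ⟨w, w', h, rfl⟩
  rw [map_mul, map_inv, mul_inv_eq_one, map_mul] at this
  exact this

/-- The generator `T_w` or the element `T_{w⁻¹}⁻¹` of the braid group, according to a sign. -/
def signedT (ε : ℤˣ) (w : W1) : P.BraidGroup :=
  if ε = 1 then P.braidT w else (P.braidT w⁻¹)⁻¹

variable {P} in
theorem signedT_mul (ε : ℤˣ) {w w' : W1} (h : P.length (w * w') = P.length w + P.length w') :
    P.signedT ε (w * w') = P.signedT ε w * P.signedT ε w' := by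
  unfold signedT
  split_ifs
  · exact braidT_mul h
  · rw [mul_inv_rev, braidT_mul, mul_inv_rev]
    rw [← mul_inv_rev, P.length_inv, P.length_inv, P.length_inv, h, add_comm]

theorem signedT_one (ε : ℤˣ) : P.signedT ε 1 = 1 := by
  have : P.braidT (1 : W1) = 1 := by
    have := braidT_mul (P := P) (w := 1) (w' := 1) (by simp [P.length_one])
    rwa [mul_one, left_eq_mul] at this
  unfold signedT
  simp [this]

/-- For `ε = 1`, clearing the inverses leaves `T_{q⁻¹} T_p = T_{q⁻¹w} T_{w⁻¹p}`, and by additivity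
of lengths both sides are `T_{q⁻¹p}`. The case `ε = -1` exchanges `p` and `q`. This is the braid
relation for galleries with one change of sign. -/
theorem signedT_mul_eq {p q w : W1} (h1 : P.length (q⁻¹ * p) = P.length q + P.length p)
    (h2 : P.length (q⁻¹ * p) = P.length (q⁻¹ * w) + P.length (p⁻¹ * w)) (ε : ℤˣ) :
    P.signedT ε p * P.signedT (-ε) (p⁻¹ * w) = P.signedT (-ε) q * P.signedT ε (q⁻¹ * w) := by
  have key : ∀ p q : W1, P.length (q⁻¹ * p) = P.length q + P.length p →
      P.length (q⁻¹ * p) = P.length (q⁻¹ * w) + P.length (p⁻¹ * w) →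
      P.braidT p * (P.braidT (p⁻¹ * w)⁻¹)⁻¹ = (P.braidT q⁻¹)⁻¹ * P.braidT (q⁻¹ * w) := by
    intro p q h1 h2
    rw [mul_inv_eq_iff_eq_mul, mul_assoc, eq_inv_mul_iff_mul_eq, ← braidT_mul, ← braidT_mul]
    · congr 1; group
    · rw [show q⁻¹ * w * (p⁻¹ * w)⁻¹ = q⁻¹ * p by group, h2, P.length_inv]
    · rw [h1, P.length_inv]
  rcases Int.units_eq_one_or ε with rfl | rfl
  · simpa [signedT] using key p q h1 h2
  · have e : P.length (p⁻¹ * q) = P.length (q⁻¹ * p) := by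
      rw [← P.length_inv]; congr 1; group
    simpa [signedT] using (key q p (by rw [e, h1, add_comm]) (by rw [e, h2, add_comm])).symm

theorem π_altProd (s t : B) (k : ℕ) : P.π (altProd (P.n s) (P.n t) k) =
    (altProd (E.cs.simple s) (E.cs.simple t) k : E.Waff) := by
  rw [ExtendedCoxeterGroup.map_altProd, π_n, π_n, ← Subgroup.subtype_apply,
    ExtendedCoxeterGroup.map_altProd]
  rfl

variable {P} in
theorem length_altProd {s t : B} {k : ℕ} (hk : k ≤ E.m s t) :
    P.length (altProd (P.n s) (P.n t) k) = k := by
  rw [length, π_altProd, E.length_coe, E.cs.length_altProd hk]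

/-- The action of `W1` on orientations, written as a left action. -/
abbrev orientationAction : MulAction W1 E.Orientation where
  smul w o := o.act (P.π w⁻¹)
  one_smul o := by
    change o.act (P.π 1⁻¹) = o
    rw [inv_one, map_one, o.act_one]
  mul_smul w w' o := by
    change o.act (P.π (w * w')⁻¹) = (o.act (P.π w'⁻¹)).act (P.π w⁻¹)
    rw [mul_inv_rev, map_mul, o.act_mul]

/-- The left component of the product in `G` reproduces the cocycle rule, so `θ` is read off from a
homomorphic section of `G → W1`, provided by `exists_hom`. -/
theorem exists_isBernsteinMap : ∃ θ : E.Orientation → W1 → P.BraidGroup, P.IsBernsteinMap θ := by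
  let _ : MulAction W1 E.Orientation := P.orientationAction
  let G := (E.Orientation → P.BraidGroup) ⋊[mulAutArrow] W1
  have hmul : ∀ (x y : G) (o : E.Orientation),
      (x * y).left o = x.left o * y.left (o.act (P.π x.right)) := by
    intro x y o
    change x.left o * y.left (o.act (P.π (x.right⁻¹)⁻¹)) = _
    rw [inv_inv]
  let g : B → G := fun s => ⟨fun o => P.signedT (o.1 1 s) (P.n s), P.n s⟩
  let j : P.Ω1 →* G :=
    { toFun := fun u => ⟨fun _ => P.braidT (u : W1), u⟩
      map_one' := SemidirectProduct.ext (funext fun _ => P.signedT_one 1) rfl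
      map_mul' := fun u u' => SemidirectProduct.ext (funext fun o => by
        rw [hmul]
        exact braidT_mul (by rw [P.length_mul_omega, P.length_omega u', add_zero])) rfl }
  have hright : ∀ s t k, (altProd (g s) (g t) k).right = altProd (P.n s) (P.n t) k := by
    intro s t k
    rw [← SemidirectProduct.rightHom_eq_right, ExtendedCoxeterGroup.map_altProd]
    rfl
  -- Along a stretch of crossings of constant sign the letters multiply to a single signed
  -- generator, as lengths add; `hsplit` then treats one change of sign.
  have hconst : ∀ k s t (o : E.Orientation) (ε : ℤˣ), k ≤ E.m s t →
      (∀ i < k, o.1 (altProd (E.simple s) (E.simple t) i) (if Even i then s else t) = ε) →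
      (altProd (g s) (g t) k).left o = P.signedT ε (altProd (P.n s) (P.n t) k) := by
    intro k
    induction k with
    | zero => intro s t o ε _ _; exact (P.signedT_one ε).symm
    | succ k ih =>
      intro s t o ε hk h
      have hk' : k ≤ E.m t s := by rw [E.m_comm]; omega
      rw [altProd, hmul, ih t s _ ε hk', altProd, signedT_mul]
      · congr 1
        have := h 0 k.succ_pos
        simp only [altProd, Even.zero, if_true] at this
        simp only [g, this]
      · have h1 := length_altProd (P := P) hk
        rw [altProd] at h1
        rw [h1, length_altProd hk', P.length_n, add_comm]
      · intro i hi
        have := h (i + 1) (by omega)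
        rw [ExtendedCoxeterGroup.Orientation.act_apply]
        simp only [g, P.π_n]
        rw [altProd] at this
        rw [← this]
        simp only [Nat.even_add_one]
        split_ifs <;> simp_all
  have hsplit : ∀ k l s t (o : E.Orientation) (ε ε' : ℤˣ), k + l ≤ E.m s t →
      (∀ i < k + l, o.1 (altProd (E.simple s) (E.simple t) i) (if Even i then s else t) =
        if i < k then ε else ε') →
      (altProd (g s) (g t) (k + l)).left o = P.signedT ε (altProd (P.n s) (P.n t) k) *
        P.signedT ε' ((altProd (P.n s) (P.n t) k)⁻¹ * altProd (P.n s) (P.n t) (k + l)) ∧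
      P.length ((altProd (P.n s) (P.n t) k)⁻¹ * altProd (P.n s) (P.n t) (k + l)) = l := by
    intro k l s t o ε ε' hm h
    rw [altProd_add (P.n s), inv_mul_cancel_left, altProd_add, hmul, hconst k s t o ε (by omega)
      fun i hi => by rw [h i (by omega), if_pos hi], hright, ← apply_ite P.n, ← apply_ite P.n,
      ← apply_ite g, ← apply_ite g]
    have hm' : l ≤ E.m (if Even k then s else t) (if Even k then t else s) := by
      split_ifs
      · omega
      · rw [E.m_comm]; omega
    refine ⟨?_, length_altProd hm'⟩
    rw [hconst l _ _ _ ε' hm']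
    intro i hi
    have := h (k + i) (by omega)
    rw [if_neg (show ¬ k + i < k by omega)] at this
    rw [ExtendedCoxeterGroup.Orientation.act_apply, ← this, altProd_add,
      ExtendedCoxeterGroup.map_altProd, P.π_n, P.π_n, apply_ite E.simple, apply_ite E.simple]
    by_cases h1 : Even k <;> by_cases h2 : Even i <;> simp [h1, h2, Nat.even_add]
  have hbraid : ∀ s t, E.m s t ≠ 0 →
      altProd (g s) (g t) (E.m s t) = altProd (g t) (g s) (E.m s t) := by
    intro s t hst
    refine SemidirectProduct.ext (funext fun o => ?_) (by rw [hright, hright, P.braid s t hst])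
    obtain ⟨f, hf, ho⟩ := o.exists_coxeterOrientation
    obtain ⟨k, hk, ε, h1, h2⟩ := hf.dihedral s t hst 1
    have hseq : ∀ s t i, E.signSeq f 1 s t i =
        o.1 (altProd (E.simple s) (E.simple t) i) (if Even i then s else t) := by
      intro s t i
      rw [ExtendedCoxeterGroup.signSeq, one_mul, ← ho, ← Subgroup.subtype_apply,
        ExtendedCoxeterGroup.map_altProd]
      rfl
    simp only [hseq] at h1 h2
    have e1 : k + (E.m s t - k) = E.m s t := by omega
    have e2 : (E.m s t - k) + k = E.m s t := by omega
    have a1 := hsplit k (E.m s t - k) s t o ε (-ε) e1.le (by rwa [e1])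
    have a2 := hsplit (E.m s t - k) k t s o (-ε) ε (by rw [E.m_comm t s, e2]) (by rwa [e2])
    rw [e1] at a1
    rw [e2] at a2
    rw [a1.1, a2.1, ← P.braid s t hst]
    rw [← P.braid s t hst] at a2
    -- Here `p` is the first `k` letters of the gallery starting with `s`, and `q` the first `m - k`
    -- letters of the one starting with `t`, each up to its change of sign. The word `q⁻¹ p` is
    -- alternating without cancellation modulo `T`, so it has length `m`.
    have hlen : P.length ((altProd (P.n t) (P.n s) (E.m s t - k))⁻¹ *
        altProd (P.n s) (P.n t) k) = E.m s t := by
      rw [length, map_mul, map_inv, π_altProd, π_altProd, ← Subgroup.coe_inv, ← Subgroup.coe_mul,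
        E.length_coe]
      rcases inv_altProd_mul_altProd (E.cs.simple_mul_simple_self s)
        (E.cs.simple_mul_simple_self t) (E.m s t - k) k with h | h
      · rw [h, e2]
        exact E.cs.length_altProd le_rfl
      · rw [h, e2]
        exact E.cs.length_altProd (E.m_comm s t).le
    refine P.signedT_mul_eq ?_ ?_ ε
    · rw [hlen, length_altProd (by rw [E.m_comm]; omega), length_altProd hk, e2]
    · rw [hlen, a1.2, a2.2, e1]
  -- The second crossing is the reverse of the first, so one factor is `T_{n_s}` and the other
  -- `T_{n_s⁻¹}⁻¹`, and their product is `T_{n_s²}`.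
  have hsq : ∀ s, g s * g s = j ⟨_, P.T_le_Ω1 (P.n_mul_n_mem_T s)⟩ := by
    intro s
    refine SemidirectProduct.ext (funext fun o => ?_) rfl
    have h2 : P.length (P.n s * P.n s) = 0 := P.length_omega ⟨_, P.T_le_Ω1 (P.n_mul_n_mem_T s)⟩
    rw [hmul]
    simp only [g, j, MonoidHom.coe_mk, OneHom.coe_mk]
    rw [ExtendedCoxeterGroup.Orientation.act_apply, mul_one, P.π_n]
    have := o.apply_mul_simple 1 s
    rw [one_mul] at this
    rw [this]
    have e1 : P.braidT (P.n s) = P.braidT (P.n s * P.n s) * P.braidT (P.n s)⁻¹ := by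
      rw [← braidT_mul, mul_inv_cancel_right]
      rw [mul_inv_cancel_right, h2, P.length_inv, zero_add]
    have e2 : P.braidT (P.n s) = P.braidT (P.n s)⁻¹ * P.braidT (P.n s * P.n s) := by
      rw [← braidT_mul, inv_mul_cancel_left]
      rw [inv_mul_cancel_left, h2, P.length_inv, add_zero]
    rcases Int.units_eq_one_or (o.1 1 s) with h | h
    · rw [h]
      simp only [signedT, if_true, show ¬(-1 : ℤˣ) = 1 by decide, if_false]
      rw [mul_inv_eq_iff_eq_mul, e1]
    · rw [h, neg_neg]
      simp only [signedT, if_true, show ¬(-1 : ℤˣ) = 1 by decide, if_false]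
      rw [inv_mul_eq_iff_eq_mul, e2]
  have hcomm : ∀ s t (u u' : P.Ω1), (u : W1) * P.n s = P.n t * u' → j u * g s = g t * j u' := by
    intro s t u u' h
    refine SemidirectProduct.ext (funext fun o => ?_) h
    rw [hmul, hmul]
    simp only [g, j, MonoidHom.coe_mk, OneHom.coe_mk]
    have hs : E.simple (E.act ⟨P.π u, u.2⟩ s) = E.simple t := by
      have h1 := congrArg P.π h
      rw [map_mul, map_mul, P.π_n, P.π_n, E.omega_mul_simple ⟨P.π u, u.2⟩] at h1
      have h2 := congrArg E.chamber h1
      rw [← E.coe_simple, ← E.coe_simple, E.chamber_mul, E.chamber_mul _ ⟨P.π u', u'.2⟩] at h2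
      rw [← E.coe_simple, h2, E.coe_simple]
    have ho : (o.act (P.π u)).1 1 s = o.1 1 t := by
      rw [← o.apply_congr_simple 1 hs, ExtendedCoxeterGroup.Orientation.act_apply, mul_one,
        ← o.apply_mul_omega 1 ⟨P.π u, u.2⟩ s, one_mul]
    rw [ho]
    -- In length `0` both signs give the same element, so `T_u` can be merged with a signed
    -- generator of either sign.
    have hu : ∀ (ε : ℤˣ) (u : P.Ω1), P.braidT (u : W1) = P.signedT ε u := fun ε u => by
      unfold signedT
      split_ifs
      · rfl
      · rw [eq_inv_iff_mul_eq_one, ← braidT_mul, mul_inv_cancel]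
        · exact P.signedT_one 1
        · rw [mul_inv_cancel, P.length_one, P.length_inv, P.length_omega]
    rw [hu (o.1 1 t) u, hu (o.1 1 t) u', ← signedT_mul, ← signedT_mul, h]
    · rw [P.length_mul_omega, P.length_omega, add_zero]
    · rw [P.length_omega_mul, P.length_omega, zero_add]
  obtain ⟨σ, hσ, hσn, hσu⟩ := P.exists_hom (G := G) SemidirectProduct.rightHom g j
    (fun s => rfl) (fun u => rfl) hsq hcomm hbraid
  refine ⟨fun o w => (σ w).left o, ⟨fun o w w' => ?_, fun o s => ?_, fun o u => ?_⟩⟩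
  · have e : (σ w).right = w := hσ w
    rw [map_mul, hmul, e]
  · simp only [hσn]
    rfl
  · simp only [hσu]
    rfl

variable {P} in
theorem IsBernsteinMap.unique {θ θ' : E.Orientation → W1 → P.BraidGroup} (h : P.IsBernsteinMap θ)
    (h' : P.IsBernsteinMap θ') : θ = θ' := by
  funext o w
  obtain ⟨l, u, -, rfl⟩ := P.exists_isReduced w
  induction l generalizing o with
  | nil => simp only [List.map_nil, List.prod_nil, one_mul]; rw [h.omega, h'.omega]
  | cons s l ih =>
    rw [List.map_cons, List.prod_cons, mul_assoc, h.cocycle, h'.cocycle, ih, h.simple, h'.simple]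

end ProPCoxeterGroup

end ProPHecke

namespace ProPHecke

namespace ExtendedCoxeterGroup

variable {B W : Type*} [Group W] {E : ExtendedCoxeterGroup B W}

/-! ### Separating walls -/

theorem separates_iff (H : E.Wall) (v v' : E.Waff) : E.Separates H v v' ↔
    ¬(E.cs.inversionCocycle v H.1 = 1 ↔ E.cs.inversionCocycle v' H.1 = 1) := by
  have h : ∀ v, E.cs.inversionCocycle v H.1 = 1 ↔ ¬ E.cs.length v < E.cs.length (H.1 * v) := by
    intro v
    rw [H.2.inversionCocycle_eq_one_iff]
    have := H.2.length_mul_right_ne v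
    omega
  rw [Separates, h, h]
  tauto

theorem inversionCocycle_conj (u : E.Ω) (v : E.Waff) (H : E.Wall) :
    E.cs.inversionCocycle (E.conj u v) (E.conj u H.1) = 1 ↔ E.cs.inversionCocycle v H.1 = 1 := by
  have hH : E.cs.IsReflection (E.conj u H.1) := by
    obtain ⟨v, s, h⟩ := H.2
    exact ⟨E.conj u v, E.act u s, by rw [h, map_mul, map_mul, map_inv, conj_omega_simple]⟩
  rw [hH.inversionCocycle_eq_one_iff, H.2.inversionCocycle_eq_one_iff, ← map_mul, length_conj,
    length_conj]

/-- The component in `Ω` of an element of `W`. -/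
noncomputable def omegaPart (w : W) : E.Ω := (E.compl.equiv w).2

theorem eq_chamber_mul (w : W) : w = (E.chamber w : W) * (E.omegaPart w : W) :=
  (E.compl.equiv.symm_apply_apply w).symm

theorem conj_eq (w : W) (v : E.Waff) : E.conj w v =
    E.chamber w * E.conj (E.omegaPart w) v * (E.chamber w)⁻¹ := by
  rw [← conj_coe, ← conj_mul, ← eq_chamber_mul]

theorem chamber_mul_eq (w w' : W) :
    E.chamber (w * w') = E.chamber w * E.conj (E.omegaPart w) (E.chamber w') := by
  conv_lhs => rw [E.eq_chamber_mul w, E.eq_chamber_mul w', mul_assoc, ← mul_assoc (E.omegaPart w : W),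
    omega_mul_coe, mul_assoc, ← mul_assoc, ← Subgroup.coe_mul, ← Subgroup.coe_mul, chamber_mul]

theorem isReflection_conj (w : W) (H : E.Wall) : E.cs.IsReflection (E.conj w H.1) := by
  obtain ⟨v, s, h⟩ := H.2
  refine ⟨E.chamber w * E.conj (E.omegaPart w) v, E.act (E.omegaPart w) s, ?_⟩
  rw [conj_eq, h, map_mul, map_mul, map_inv, conj_omega_simple]
  group

/-- The action of `W` on the walls by conjugation. -/
def conjWall (w : W) : E.Wall ≃ E.Wall where
  toFun H := ⟨E.conj w H.1, isReflection_conj w H⟩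
  invFun H := ⟨E.conj w⁻¹ H.1, isReflection_conj w⁻¹ H⟩
  left_inv H := Subtype.ext (Subtype.ext (by simp only [coe_conj]; group))
  right_inv H := Subtype.ext (Subtype.ext (by simp only [coe_conj]; group))

open scoped Classical in
theorem X_apply (w w' : W) (H : E.Wall) : E.X w w' H =
    if E.Separates H 1 (E.chamber w) ∧ E.Separates H (E.chamber w) (E.chamber (w * w')) then 1
    else 0 := by
  have hfin : {H : E.Wall | E.Separates H 1 (E.chamber w) ∧
      E.Separates H (E.chamber w) (E.chamber (w * w'))}.Finite := by
    -- Walls separating `1` from `w` lie in the finite support of the inversion cocycle; otherwise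
    -- the `finsum` would default to `0`.
    refine Set.Finite.subset ((E.cs.inversionCocycle (E.chamber w)).support.finite_toSet.preimage
      Subtype.val_injective.injOn) fun H hH => ?_
    have h := (separates_iff _ _ _).1 hH.1
    rw [E.cs.inversionCocycle_one] at h
    simp only [Set.mem_preimage, Finset.mem_coe, Finsupp.mem_support_iff]
    intro h0
    rw [h0] at h
    exact h (by simp)
  rw [X, finsum_mem_eq_finite_toFinset_sum _ hfin, Finsupp.finsetSum_apply]
  simp only [Finsupp.single_apply, Finset.sum_ite_eq', Set.Finite.mem_toFinset, Set.mem_ofPred_eq]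

/-! ### Walls crossed negatively -/

/-- The dihedral axiom says that the second sign sequence is the first one reversed: entry `m - 1 -
i` of the second is `-ε` exactly when `k ≤ i`. -/
theorem Orientation.exists_crossingSum (o : E.Orientation) :
    ∃ D : E.Waff → E.Waff → E.Waff →₀ ℤ,
      (∀ v s, D v (E.cs.simple s) = Finsupp.single (v * E.cs.simple s * v⁻¹) (o.1 v s : ℤ)) ∧
      ∀ v w w', D v (w * w') = D v w + D (v * w) w' := by
  obtain ⟨f, hf, ho⟩ := o.exists_coxeterOrientation
  simp only [ho]
  refine E.cs.exists_crossingCocycle _ (fun v s => by rw [hf.neg, Units.val_neg])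
    fun s t hst v i hi => ?_
  obtain ⟨k, hk, ε, h1, h2⟩ := hf.dihedral s t hst v
  have hi' : i < E.m s t := hi
  have e1 := h1 i hi'
  have e2 := h2 (E.m s t - 1 - i) (by omega)
  change (E.signSeq f v s t i : ℤ) = (E.signSeq f v t s (E.m s t - 1 - i) : ℤ)
  rw [e1, e2]
  by_cases h : i < k
  · rw [if_pos h, if_neg (by omega)]
  · rw [if_neg h, if_pos (by omega)]

/-- The sum of the walls crossed by a gallery from `v` to `v w`, each with the sign that the
orientation `o` gives to the crossing. -/
noncomputable def Orientation.crossingSum (o : E.Orientation) : E.Waff → E.Waff → E.Waff →₀ ℤ :=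
  o.exists_crossingSum.choose

namespace Orientation

theorem crossingSum_simple (o : E.Orientation) (v : E.Waff) (s : B) :
    o.crossingSum v (E.cs.simple s) =
      Finsupp.single (v * E.cs.simple s * v⁻¹) (o.1 v s : ℤ) :=
  o.exists_crossingSum.choose_spec.1 v s

theorem crossingSum_mul (o : E.Orientation) (v w w' : E.Waff) :
    o.crossingSum v (w * w') = o.crossingSum v w + o.crossingSum (v * w) w' :=
  o.exists_crossingSum.choose_spec.2 v w w'

theorem crossingSum_one (o : E.Orientation) (v : E.Waff) : o.crossingSum v 1 = 0 := by
  simpa using o.crossingSum_mul v 1 1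

/-- Translation of a gallery by `w` turns the orientation `o • w` into `o` and conjugates the walls
crossed. -/
theorem crossingSum_act (o : E.Orientation) (w : W) (v v' t : E.Waff) :
    (o.act w).crossingSum v v' t =
      o.crossingSum (E.chamber w * E.conj (E.omegaPart w) v) (E.conj (E.omegaPart w) v')
        (E.conj w t) := by
  induction v' using E.cs.simple_induction_left generalizing v with
  | one => simp [crossingSum_one]
  | mul_simple_left v' s ih =>
    rw [crossingSum_mul, map_mul, crossingSum_mul, Finsupp.add_apply, Finsupp.add_apply, ih,
      map_mul, mul_assoc, conj_omega_simple, crossingSum_simple, crossingSum_simple]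
    congr 1
    have h1 : (o.act w).1 v s =
        o.1 (E.chamber w * E.conj (E.omegaPart w) v : E.Waff) (E.act (E.omegaPart w) s) := by
      rw [act_apply, ← apply_mul_omega, Subgroup.coe_mul, mul_assoc, ← omega_mul_coe, ← mul_assoc,
        ← eq_chamber_mul]
    have h2 : E.chamber w * E.conj (E.omegaPart w) v * E.cs.simple (E.act (E.omegaPart w) s) *
        (E.chamber w * E.conj (E.omegaPart w) v)⁻¹ = E.conj w (v * E.cs.simple s * v⁻¹) := by
      rw [conj_eq w, map_mul, map_mul, map_inv, conj_omega_simple]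
      group
    rw [h1, h2]
    classical
    simp only [Finsupp.single_apply, EmbeddingLike.apply_eq_iff_eq]

end Orientation

open scoped Classical in
-- A crossing of sign `ε` counts `(1 - ε)/2` times as a negative crossing; the factor `2` avoids the
-- division.
theorem two_mul_negWalls (o : E.Orientation) (l : List B) (v : E.Waff) (H : E.Wall) :
    2 * (E.negWalls o v l H : ℤ) =
      ((E.cs.leftInvSeq l).map fun t => if v * t * v⁻¹ = H.1 then (1 : ℤ) else 0).sum -
        o.crossingSum v (E.cs.wordProd l) H.1 := by
  induction l generalizing v with
  | nil => simp [negWalls, o.crossingSum_one]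
  | cons s l ih =>
    rw [negWalls, Finsupp.add_apply, Nat.cast_add, mul_add, ih, E.cs.wordProd_cons,
      o.crossingSum_mul, o.crossingSum_simple, Finsupp.add_apply, CoxeterSystem.leftInvSeq,
      List.map_cons, List.sum_cons, List.map_map]
    have e : ((fun t => if v * t * v⁻¹ = H.1 then (1 : ℤ) else 0) ∘ ⇑(MulAut.conj (E.cs.simple s))) =
        fun t => if v * E.cs.simple s * t * (v * E.cs.simple s)⁻¹ = H.1 then (1 : ℤ) else 0 := by
      funext t
      simp only [Function.comp_apply, MulAut.conj_apply, mul_inv_rev, mul_assoc]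
    have hw : (E.wall v s = H) ↔ v * E.cs.simple s * v⁻¹ = H.1 := Subtype.ext_iff
    rw [e]
    have h3 : 2 * ((if o.1 v s = -1 then Finsupp.single (E.wall v s) 1 else 0 : E.WallMonoid) H : ℤ) =
        (if v * E.cs.simple s * v⁻¹ = H.1 then (1 : ℤ) else 0) -
          Finsupp.single (v * E.cs.simple s * v⁻¹) (o.1 v s : ℤ) H.1 := by
      rcases Int.units_eq_one_or (o.1 v s) with h | h <;>
        by_cases h' : v * E.cs.simple s * v⁻¹ = H.1 <;>
        simp [h, h', hw, Finsupp.single_apply]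
    rw [h3]
    ring

open scoped Classical in
-- A reduced gallery crosses each wall at most once, so its crossings are counted by the inversion
-- indicator. The right side no longer depends on the word, which makes `γ` well defined.
theorem two_mul_negWalls_of_isReduced (o : E.Orientation) {l : List B} (hl : E.cs.IsReduced l)
    (H : E.Wall) : 2 * (E.negWalls o 1 l H : ℤ) =
      (if E.cs.inversionCocycle (E.cs.wordProd l) H.1 = 1 then 1 else 0) -
        o.crossingSum 1 (E.cs.wordProd l) H.1 := by
  rw [two_mul_negWalls, E.cs.inversionCocycle_apply_of_nodup hl.nodup_leftInvSeq]
  congr 1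
  have := hl.nodup_leftInvSeq
  generalize E.cs.leftInvSeq l = L at this
  induction L with
  | nil => simp
  | cons r L ih =>
    rw [List.nodup_cons] at this
    rw [List.map_cons, List.sum_cons, ih this.2]
    by_cases h : r = H.1
    · simp [h ▸ this.1, h]
    · simp [h, Ne.symm h]

theorem existsUnique_isNegWallProduct (o : E.Orientation) :
    ∃! g : W → E.WallMonoid, E.IsNegWallProduct o g := by
  choose l u hl hw using E.exists_isReduced
  refine ⟨fun w => E.negWalls o 1 (l w), ?_, ?_⟩
  · intro l' u' h
    rw [isReduced_iff] at h
    set w := (l'.map E.simple).prod * (u' : W) with hw'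
    have hc : E.cs.wordProd (l w) = E.cs.wordProd l' := by
      have h1 := congrArg E.chamber (hw w)
      conv_lhs at h1 => rw [hw']
      rwa [← coe_wordProd, ← coe_wordProd, chamber_mul, chamber_mul, eq_comm] at h1
    ext H
    change E.negWalls o 1 (l w) H = _
    have h1 := two_mul_negWalls_of_isReduced o (hl w) H
    have h2 := two_mul_negWalls_of_isReduced o h H
    rw [hc] at h1
    omega
  · intro g hg
    funext w
    have h1 := hg (l w) (u w) ((isReduced_iff E (l w) (u w)).2 (hl w))
    rwa [← hw w] at h1

open scoped Classical in
theorem IsNegWallProduct.two_mul {o : E.Orientation} {γ : W → E.WallMonoid}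
    (h : E.IsNegWallProduct o γ) (w : W) (H : E.Wall) : 2 * (γ w H : ℤ) =
      (if E.cs.inversionCocycle (E.chamber w) H.1 = 1 then 1 else 0) -
        o.crossingSum 1 (E.chamber w) H.1 := by
  obtain ⟨l, u, hl, rfl⟩ := E.exists_isReduced w
  rw [h l u ((isReduced_iff E l u).2 hl), two_mul_negWalls_of_isReduced o hl, ← coe_wordProd,
    chamber_mul]

/-- After doubling, the signed sums cancel by the cocycle rule. With `x`, `y` the inversion values
mod 2 contributed by `w` and `w'` at the wall, what remains is `[x] + [y] - [x + y]`. This is `2`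
exactly when `x = y = 1`, that is, when the wall is crossed on both stretches. -/
theorem IsNegWallProduct.add_mapDomain {γ : E.Orientation → W → E.WallMonoid}
    (h : ∀ o, E.IsNegWallProduct o (γ o)) (o : E.Orientation) (w w' : W) :
    γ o w + (γ (o.act w) w').mapDomain (conjWall w) = E.X w w' + γ o (w * w') := by
  ext H
  obtain ⟨H', rfl⟩ := (conjWall (E := E) w).surjective H
  rw [Finsupp.add_apply, Finsupp.add_apply, Finsupp.mapDomain_apply (conjWall w).injective]
  have h1 := (h o).two_mul w (conjWall w H')
  have h2 := (h (o.act w)).two_mul w' H'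
  have h3 := (h o).two_mul (w * w') (conjWall w H')
  have hX := X_apply w w' (conjWall w H')
  rw [separates_iff, separates_iff, E.cs.inversionCocycle_one] at hX
  have hc : (E.chamber w)⁻¹ * E.conj w H'.1 * E.chamber w = E.conj (E.omegaPart w) H'.1 := by
    rw [conj_eq]; group
  have hi := inversionCocycle_conj (E.omegaPart w) (E.chamber w') H'
  have hval : (conjWall w H').1 = E.conj w H'.1 := rfl
  rw [Orientation.crossingSum_act, map_one, mul_one] at h2
  rw [chamber_mul_eq, E.cs.inversionCocycle_mul, o.crossingSum_mul, Finsupp.add_apply, hval, hc,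
    one_mul] at h3
  rw [chamber_mul_eq, E.cs.inversionCocycle_mul, hval, hc] at hX
  rw [hval] at h1
  simp only [← hi] at h2
  generalize E.cs.inversionCocycle (E.chamber w) (E.conj w H'.1) = x at *
  generalize E.cs.inversionCocycle (E.conj (E.omegaPart w) (E.chamber w'))
    (E.conj (E.omegaPart w) H'.1) = y at *
  have hz : ∀ x : ZMod 2, x = 0 ∨ x = 1 := by decide
  have h11 : (1 + 1 : ZMod 2) = 0 := rfl
  rcases hz x with rfl | rfl <;> rcases hz y with rfl | rfl <;> simp [h11] at h1 h2 h3 hX <;>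
    omega

/-! ### Specialization of formal products of walls -/

variable {R : Type*} {a : B → R}

/-- If `v t v⁻¹ = w s w⁻¹`, then `v⁻¹ w` intertwines `t` and `s`, so the chosen representative does
not matter. -/
theorem aWall_eq (ha : ∀ s t (w : W), E.simple s * w = w * E.simple t → a s = a t) {H : E.Wall}
    {w : W} {s : B} (h : (H.1 : W) = w * E.simple s * w⁻¹) : E.aWall a H = a s := by
  have h1 := H.2.choose_spec.choose_spec
  set v := H.2.choose
  set t := H.2.choose_spec.choose with ht
  have h2 : (H.1 : W) = v * E.simple t * (v : W)⁻¹ := by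
    conv_lhs => rw [h1]
    rfl
  refine ha t s ((v : W)⁻¹ * w) ?_
  rw [h2, eq_mul_inv_iff_mul_eq] at h
  rw [mul_assoc, ← h]
  group

variable [CommRing R]

theorem specialize_zero : E.specialize a 0 = 1 := Finsupp.prod_zero_index

theorem specialize_add (x y : E.WallMonoid) :
    E.specialize a (x + y) = E.specialize a x * E.specialize a y :=
  Finsupp.prod_add_index' (fun _ => pow_zero _) fun _ _ _ => pow_add _ _ _

theorem specialize_single (H : E.Wall) : E.specialize a (Finsupp.single H 1) = E.aWall a H := by
  rw [specialize, Finsupp.prod_single_index (h := fun H k => E.aWall a H ^ k) (pow_zero _), pow_one]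

theorem specialize_mapDomain (ha : ∀ s t (w : W), E.simple s * w = w * E.simple t → a s = a t)
    (w : W) (x : E.WallMonoid) :
    E.specialize a (x.mapDomain (conjWall w)) = E.specialize a x := by
  rw [specialize, Finsupp.prod_mapDomain_index (fun _ => pow_zero _) fun _ _ _ => pow_add _ _ _]
  refine Finsupp.prod_congr fun H _ => ?_
  congr 1
  obtain ⟨v, s, h⟩ := H.2
  have h1 : (H.1 : W) = v * E.simple s * (v : W)⁻¹ := by rw [h]; rfl
  rw [aWall_eq ha h1]
  refine aWall_eq ha (w := w * v) ?_
  change (E.conj w H.1 : W) = _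
  rw [coe_conj, h1]
  group

end ExtendedCoxeterGroup

end ProPHecke

namespace ProPHecke

namespace ProPCoxeterGroup

variable {B W W1 : Type*} [Group W] [Group W1] {E : ExtendedCoxeterGroup B W}
  {P : ProPCoxeterGroup E W1} {R : Type*} [CommRing R] {a : B → R} {b : B → MonoidAlgebra R P.T}

/-! ### Integral Bernstein maps for invertible parameters -/

theorem heckeT_mul_ofRT (w : W1) (x : MonoidAlgebra R P.T) :
    P.heckeT a b w * P.ofRT a b x =
      P.ofRT a b (MonoidAlgebra.mapDomain (fun t : P.T => MulAut.conjNormal w t) x) *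
        P.heckeT a b w := by
  induction x using MonoidAlgebra.induction_linear with
  | zero => simp [ofRT_zero]
  | add x y hx hy =>
    rw [MonoidAlgebra.mapDomain_add, ofRT_add, ofRT_add, mul_add, add_mul, hx, hy]
  | single t r =>
    rw [MonoidAlgebra.mapDomain_single, ofRT_single, ofRT_single, mul_smul_comm, smul_mul_assoc,
      ← heckeT_mul_T, ← heckeT_T_mul, MulAut.conjNormal_apply, inv_mul_cancel_right]

theorem IsParameter.commute_ofRT (hab : P.IsParameter a b) (s : B) :
    P.heckeT a b (P.n s) * P.ofRT a b (b s) = P.ofRT a b (b s) * P.heckeT a b (P.n s) := by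
  have h := (hab s s (P.n s) (by rw [P.π_n])).2
  have e : (⟨P.n s * P.n s * (P.n s)⁻¹ * (P.n s)⁻¹, P.mem_T (by rw [P.π_n])⟩ : P.T) = 1 :=
    Subtype.ext (by simp)
  rw [e, ← MonoidAlgebra.one_def, one_mul] at h
  rw [heckeT_mul_ofRT, h]

theorem isUnit_heckeT_omega (u : P.Ω1) : IsUnit (P.heckeT a b (u : W1)) := by
  refine ⟨⟨P.heckeT a b (u : W1), P.heckeT a b ((u⁻¹ : P.Ω1) : W1), ?_, ?_⟩, rfl⟩
  · rw [← heckeT_mul_omega, ← Subgroup.coe_mul, mul_inv_cancel, Subgroup.coe_one, heckeT_one]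
  · rw [← heckeT_mul_omega, ← Subgroup.coe_mul, inv_mul_cancel, Subgroup.coe_one, heckeT_one]

/-- Multiplied by the unit `T_{n_s²}`, this is the quadratic relation. It links the factor `T_{n_s}
- b_s` of the integral map to the factor `T_{n_s⁻¹}⁻¹` of `θ`. -/
theorem heckeT_inv_mul_sub (s : B) :
    P.heckeT a b (P.n s)⁻¹ * (P.heckeT a b (P.n s) - P.ofRT a b (b s)) = algebraMap R _ (a s) := by
  have hu : IsUnit (P.heckeT a b (P.n s * P.n s)) :=
    isUnit_heckeT_omega ⟨_, P.T_le_Ω1 (P.n_mul_n_mem_T s)⟩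
  apply hu.mul_left_cancel
  rw [← mul_assoc, ← P.heckeT_T_mul a b ⟨_, P.n_mul_n_mem_T s⟩, mul_inv_cancel_right, mul_sub,
    heckeT_mul_self, add_sub_cancel_right, ← Algebra.commutes, Algebra.smul_def]

theorem IsParameter.sub_mul_heckeT_inv (hab : P.IsParameter a b) (s : B) :
    (P.heckeT a b (P.n s) - P.ofRT a b (b s)) * P.heckeT a b (P.n s)⁻¹ = algebraMap R _ (a s) := by
  have hu : IsUnit (P.heckeT a b (P.n s * P.n s)) :=
    isUnit_heckeT_omega ⟨_, P.T_le_Ω1 (P.n_mul_n_mem_T s)⟩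
  apply hu.mul_right_cancel
  rw [mul_assoc, ← P.heckeT_mul_T a b _ ⟨_, P.n_mul_n_mem_T s⟩, inv_mul_cancel_left, sub_mul,
    heckeT_mul_self, hab.commute_ofRT, add_sub_cancel_right, Algebra.smul_def]

theorem IsParameter.isUnit_heckeT (hab : P.IsParameter a b) (ha : ∀ s, IsUnit (a s)) (w : W1) :
    IsUnit (P.heckeT a b w) := by
  have hn : ∀ s, IsUnit (P.heckeT a b (P.n s)) := fun s => by
    obtain ⟨r, hr⟩ := (ha s).exists_right_inv
    have hr' : algebraMap R (P.HeckeAlgebra a b) (a s) * algebraMap R _ r = 1 := by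
      rw [← map_mul, hr, map_one]
    have h1 : IsUnit (P.heckeT a b (P.n s)⁻¹) := by
      refine ⟨⟨P.heckeT a b (P.n s)⁻¹, (P.heckeT a b (P.n s) - P.ofRT a b (b s)) *
        algebraMap R _ r, ?_, ?_⟩, rfl⟩
      · rw [← mul_assoc, heckeT_inv_mul_sub, hr']
      · rw [mul_assoc, Algebra.commutes, ← mul_assoc, hab.sub_mul_heckeT_inv, hr']
    have h2 := P.heckeT_T_mul a b ⟨_, P.n_mul_n_mem_T s⟩ (P.n s)⁻¹
    rw [mul_inv_cancel_right] at h2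
    rw [h2]
    exact (isUnit_heckeT_omega ⟨_, P.T_le_Ω1 (P.n_mul_n_mem_T s)⟩).mul h1
  obtain ⟨l, u, hl, rfl⟩ := P.exists_isReduced w
  rw [heckeT_mul_omega, P.heckeT_prod a b hl]
  refine IsUnit.mul ?_ (isUnit_heckeT_omega u)
  clear hl
  induction l with
  | nil => simp
  | cons s l ih =>
    rw [List.map_cons, List.prod_cons]
    exact (hn s).mul ih

theorem IsParameter.exists_braidHom (hab : P.IsParameter a b) (ha : ∀ s, IsUnit (a s)) :
    ∃ φ : P.BraidGroup →* P.HeckeAlgebra a b, ∀ w, φ (P.braidT w) = P.heckeT a b w := by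
  let f : W1 → (P.HeckeAlgebra a b)ˣ := fun w => (hab.isUnit_heckeT ha w).unit
  refine ⟨(Units.coeHom _).comp (PresentedGroup.toGroup (f := f) ?_), fun w => ?_⟩
  · rintro _ ⟨w, w', h, rfl⟩
    rw [map_mul, map_inv, map_mul, FreeGroup.lift_apply_of, FreeGroup.lift_apply_of,
      FreeGroup.lift_apply_of, mul_inv_eq_one]
    exact Units.ext (heckeT_mul a b h)
  · rw [MonoidHom.comp_apply, braidT, PresentedGroup.toGroup.of]
    rfl

theorem IsParameter.a_eq_of_simple_mul (hab : P.IsParameter a b) :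
    ∀ s t (w : W), E.simple s * w = w * E.simple t → a s = a t := by
  intro s t w h
  obtain ⟨w, rfl⟩ := P.surj w
  exact hab.a_eq h

/-- Letter by letter, a negative crossing of `H` turns `φ(θ(n_s))` into `T_{n_s} - b_s` at the cost
of `a_s = a_H`; the cocycle rule assembles the letters. -/
theorem IsParameter.intProd_mul_eq (hab : P.IsParameter a b)
    {φ : P.BraidGroup →* P.HeckeAlgebra a b} (hφ : ∀ w, φ (P.braidT w) = P.heckeT a b w)
    {θ : E.Orientation → W1 → P.BraidGroup} (hθ : P.IsBernsteinMap θ) (o : E.Orientation)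
    (u : P.Ω1) (l : List B) (v : E.Waff) :
    P.intProd a b o v l * P.heckeT a b (u : W1) =
      E.specialize a (E.negWalls o v l) • φ (θ (o.act v) ((l.map P.n).prod * u)) := by
  induction l generalizing v with
  | nil =>
    rw [intProd, ExtendedCoxeterGroup.negWalls, E.specialize_zero, one_mul, one_smul, List.map_nil,
      List.prod_nil, one_mul, hθ.omega, hφ]
  | cons s l ih =>
    have h1 := ih (v * E.cs.simple s)
    rw [Subgroup.coe_mul, E.coe_simple] at h1
    have h2 : (if o.1 v s = 1 then P.heckeT a b (P.n s)
          else P.heckeT a b (P.n s) - P.ofRT a b (b s)) =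
        E.specialize a (if o.1 v s = -1 then Finsupp.single (E.wall v s) 1 else 0) •
          φ (θ (o.act v) (P.n s)) := by
      rw [hθ.simple, ExtendedCoxeterGroup.Orientation.act_apply, mul_one]
      by_cases h : o.1 v s = 1
      · rw [if_pos h, if_pos h, if_neg (by rw [h]; decide), E.specialize_zero, one_smul, hφ]
      · have h' := (Int.units_eq_one_or (o.1 v s)).resolve_left h
        have hw : ((E.wall v s).1 : W) = v * E.simple s * (v : W)⁻¹ := rfl
        rw [if_neg h, if_neg h, if_pos h', E.specialize_single,
          E.aWall_eq hab.a_eq_of_simple_mul hw, Algebra.smul_def, Algebra.commutes,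
          ← heckeT_inv_mul_sub s, ← mul_assoc, ← hφ (P.n s)⁻¹, ← map_mul, inv_mul_cancel, map_one,
          one_mul]
    have h3 : φ (θ (o.act v) (((s :: l).map P.n).prod * u)) = φ (θ (o.act v) (P.n s)) *
        φ (θ (o.act ((v : W) * E.simple s)) ((l.map P.n).prod * u)) := by
      rw [List.map_cons, List.prod_cons, mul_assoc, hθ.cocycle, map_mul, ← o.act_mul, P.π_n]
    rw [intProd, ExtendedCoxeterGroup.negWalls, E.specialize_add, mul_assoc, h1, h2, h3,
      smul_mul_smul_comm]

/-- Integral Bernstein maps for all orientations that satisfy the product rule. -/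
structure IsIntegralBernsteinFamily (a : B → R) (b : B → MonoidAlgebra R P.T)
    (f : E.Orientation → W1 → P.HeckeAlgebra a b) : Prop where
  isIntegralBernstein : ∀ o, P.IsIntegralBernstein a b o (f o)
  mul : ∀ o w w', f o w * f (o.act (P.π w)) w' =
    E.specialize a (E.X (P.π w) (P.π w')) • f o (w * w')

theorem IsParameter.isIntegralBernsteinFamily_of_braidHom (hab : P.IsParameter a b)
    {φ : P.BraidGroup →* P.HeckeAlgebra a b} (hφ : ∀ w, φ (P.braidT w) = P.heckeT a b w)
    {θ : E.Orientation → W1 → P.BraidGroup} (hθ : P.IsBernsteinMap θ)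
    {γ : E.Orientation → W → E.WallMonoid} (hγ : ∀ o, E.IsNegWallProduct o (γ o)) :
    IsIntegralBernsteinFamily a b fun o w => E.specialize a (γ o (P.π w)) • φ (θ o w) where
  isIntegralBernstein o l u h := by
    have h1 := hab.intProd_mul_eq hφ hθ o u l 1
    rw [Subgroup.coe_one, o.act_one] at h1
    dsimp only
    rw [h1, map_mul, P.π_prod_n]
    rw [length, map_mul, P.π_prod_n] at h
    rw [hγ o l ⟨P.π u, u.2⟩ h]
  mul o w w' := by
    rw [hθ.cocycle, map_mul, smul_mul_smul_comm, smul_smul, map_mul,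
      ← E.specialize_mapDomain hab.a_eq_of_simple_mul (P.π w) (γ (o.act _) _),
      ← E.specialize_add, ExtendedCoxeterGroup.IsNegWallProduct.add_mapDomain hγ,
      E.specialize_add]

theorem IsIntegralBernstein.unique {o : E.Orientation} {f g : W1 → P.HeckeAlgebra a b}
    (hf : P.IsIntegralBernstein a b o f) (hg : P.IsIntegralBernstein a b o g) : f = g := by
  funext w
  obtain ⟨l, u, hl, rfl⟩ := P.exists_isReduced w
  rw [hf l u (P.length_prod l hl u), hg l u (P.length_prod l hl u)]

/-! ### Base change -/

variable {R' : Type*} [CommRing R'] {a' : B → R'} {b' : B → MonoidAlgebra R' P.T}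

/-- The condition on `a` only compares values, so `a'` need not be the image of `a`. This permits
the deformation `X + a_s`. -/
theorem IsParameter.map (hab : P.IsParameter a b) (f : R →+* R')
    (ha' : ∀ s t, a s = a t → a' s = a' t) :
    P.IsParameter a' fun s => MonoidAlgebra.mapRingHom P.T f (b s) := by
  intro s t w h
  obtain ⟨h1, h2⟩ := hab s t w h
  refine ⟨ha' s t h1, ?_⟩
  dsimp only
  rw [← h2, map_mul, MonoidAlgebra.mapRingHom_single, map_one]
  congr 1
  generalize b t = x
  induction x using MonoidAlgebra.induction_linear with
  | zero => simp
  | add x y hx hy => simp only [map_add, MonoidAlgebra.mapDomain_add, hx, hy]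
  | single t r => simp only [MonoidAlgebra.mapRingHom_single, MonoidAlgebra.mapDomain_single]

theorem exists_baseChange (f : R →+* R') (ha' : ∀ s, a' s = f (a s))
    (hb' : ∀ s, b' s = MonoidAlgebra.mapRingHom P.T f (b s)) :
    ∃ F : P.HeckeAlgebra a b →+* P.HeckeAlgebra a' b',
      (∀ w, F (P.heckeT a b w) = P.heckeT a' b' w) ∧ (∀ r x, F (r • x) = f r • F x) ∧
      ∀ o v l, F (P.intProd a b o v l) = P.intProd a' b' o v l := by
  -- Restriction of scalars along `f`, so that the presentation over `R` can be mapped to the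
  -- algebra over `R'`.
  let _ : Algebra R (P.HeckeAlgebra a' b') := Algebra.compHom _ f
  have hsmul : ∀ (r : R) (x : P.HeckeAlgebra a' b'), r • x = f r • x := fun _ _ => rfl
  have hsum : ∀ x : MonoidAlgebra R P.T, (x.coeff.sum fun t r => r • P.heckeT a' b' (t : W1)) =
      P.ofRT a' b' (MonoidAlgebra.mapRingHom P.T f x) := by
    intro x
    induction x using MonoidAlgebra.induction_linear with
    | zero => simp [ofRT_zero]
    | add x y hx hy =>
      rw [MonoidAlgebra.coeff_add, Finsupp.sum_add_index', hx, hy, map_add, ofRT_add]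
      · simp
      · simp [add_smul]
    | single t r => rw [MonoidAlgebra.mapRingHom_single, ofRT_single]; simp [hsmul]
  have hrel : ∀ ⦃x y⦄, P.HeckeRel a b x y → FreeAlgebra.lift R (P.heckeT a' b') x =
      FreeAlgebra.lift R (P.heckeT a' b') y := by
    intro x y hxy
    cases hxy with
    | one => rw [FreeAlgebra.lift_ι_apply, map_one, heckeT_one]
    | mul w w' h =>
      rw [map_mul, FreeAlgebra.lift_ι_apply, FreeAlgebra.lift_ι_apply, FreeAlgebra.lift_ι_apply,
        heckeT_mul a' b' h]
    | quad s =>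
      simp only [map_mul, map_add, map_smul, map_finsuppSum, FreeAlgebra.lift_ι_apply]
      rw [heckeT_mul_self, hsum, hb', ha']
      rfl
  let F := RingQuot.liftAlgHom R ⟨FreeAlgebra.lift R (P.heckeT a' b'), hrel⟩
  have hF : ∀ w, F (P.heckeT a b w) = P.heckeT a' b' w := fun w => by
    rw [heckeT, RingQuot.liftAlgHom_mkAlgHom_apply, FreeAlgebra.lift_ι_apply]
  have hFb : ∀ s, F (P.ofRT a b (b s)) = P.ofRT a' b' (b' s) := fun s => by
    rw [ofRT, map_finsuppSum, hb', ← hsum]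
    simp only [map_smul, hF]
  refine ⟨F.toRingHom, hF, fun r x => map_smul F r x, fun o v l => ?_⟩
  change F _ = _
  induction l generalizing v with
  | nil => rw [intProd, intProd, map_one]
  | cons s l ih =>
    rw [intProd, intProd, map_mul, ih]
    congr 1
    split_ifs
    · exact hF _
    · rw [map_sub, hF, hFb]

/-- The map sends `T_w` to `T_w` and is injective on coefficients; spanning in the source and
independence in the target suffice. -/
theorem baseChange_injective {f : R →+* R'} (hf : Function.Injective f)
    (hab' : P.IsParameter a' b') {F : P.HeckeAlgebra a b →+* P.HeckeAlgebra a' b'}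
    (hF : ∀ w, F (P.heckeT a b w) = P.heckeT a' b' w) (hF' : ∀ r x, F (r • x) = f r • F x) :
    Function.Injective F := by
  rw [injective_iff_map_eq_zero]
  intro x hx
  have hmem : x ∈ Submodule.span R (Set.range (P.heckeT a b)) := by
    rw [P.span_heckeT a b]; trivial
  obtain ⟨c, rfl⟩ := Finsupp.mem_span_range_iff_exists_finsupp.1 hmem
  rw [map_finsuppSum] at hx
  simp only [hF', hF] at hx
  have h1 := linearIndependent_iff.1 hab'.linearIndependent_heckeT (c.mapRange f (map_zero f)) (by
    rw [Finsupp.linearCombination_apply, Finsupp.sum_mapRange_index (by simp)]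
    exact hx)
  have h2 : c = 0 := by
    ext w
    have := DFunLike.congr_fun h1 w
    rw [Finsupp.mapRange_apply] at this
    exact hf (by rw [this]; simp)
  rw [h2, Finsupp.sum_zero_index]

theorem map_specialize (f : R →+* R') (ha' : ∀ s, a' s = f (a s)) (x : E.WallMonoid) :
    f (E.specialize a x) = E.specialize a' x := by
  rw [ExtendedCoxeterGroup.specialize, map_finsuppProd]
  refine Finsupp.prod_congr fun H _ => ?_
  rw [map_pow, ExtendedCoxeterGroup.aWall, ExtendedCoxeterGroup.aWall, ha']

theorem IsIntegralBernsteinFamily.map (f : R →+* R') (ha' : ∀ s, a' s = f (a s))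
    (hb' : ∀ s, b' s = MonoidAlgebra.mapRingHom P.T f (b s))
    {g : E.Orientation → W1 → P.HeckeAlgebra a b} (hg : IsIntegralBernsteinFamily a b g) :
    ∃ g' : E.Orientation → W1 → P.HeckeAlgebra a' b', IsIntegralBernsteinFamily a' b' g' := by
  obtain ⟨F, hT, hsmul, hint⟩ := exists_baseChange f ha' hb'
  refine ⟨fun o w => F (g o w), fun o l u h => ?_, fun o w w' => ?_⟩
  · rw [hg.isIntegralBernstein o l u h, map_mul, hT, hint]
  · rw [← map_mul, hg.mul, hsmul, map_specialize f ha']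

/-- The values over `R'` are given by `intProd` and so come from the algebra over `R`. All
identities can be tested after the injective base change. -/
theorem IsIntegralBernsteinFamily.comap (f : R →+* R') (hf : Function.Injective f)
    (ha' : ∀ s, a' s = f (a s)) (hb' : ∀ s, b' s = MonoidAlgebra.mapRingHom P.T f (b s))
    (hab' : P.IsParameter a' b')
    {g' : E.Orientation → W1 → P.HeckeAlgebra a' b'} (hg : IsIntegralBernsteinFamily a' b' g') :
    ∃ g : E.Orientation → W1 → P.HeckeAlgebra a b, IsIntegralBernsteinFamily a b g := by
  obtain ⟨F, hT, hsmul, hint⟩ := exists_baseChange f ha' hb'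
  have hinj := baseChange_injective hf hab' hT hsmul
  choose l u hl hw using P.exists_isReduced
  have hFg : ∀ o w, F (P.intProd a b o 1 (l w) * P.heckeT a b (u w : W1)) = g' o w := by
    intro o w
    conv_rhs => rw [hw w]
    rw [map_mul, hT, hint, hg.isIntegralBernstein o (l w) (u w) (P.length_prod _ (hl w) _)]
  refine ⟨fun o w => P.intProd a b o 1 (l w) * P.heckeT a b (u w : W1), fun o l' u' h => ?_,
    fun o w w' => ?_⟩
  · apply hinj
    rw [hFg, map_mul, hT, hint, hg.isIntegralBernstein o l' u' h]
  · apply hinj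
    rw [map_mul, hFg, hFg, hsmul, hFg, hg.mul, map_specialize f ha']

/-! ### Arbitrary parameters and the main theorem. -/

theorem IsParameter.exists_isIntegralBernsteinFamily (hab : P.IsParameter a b) :
    ∃ g : E.Orientation → W1 → P.HeckeAlgebra a b, IsIntegralBernsteinFamily a b g := by
  let a₁ : B → Polynomial R := fun s => Polynomial.X + Polynomial.C (a s)
  let b₁ : B → MonoidAlgebra (Polynomial R) P.T := fun s =>
    MonoidAlgebra.mapRingHom P.T Polynomial.C (b s)
  let K := FractionRing (Polynomial R)
  let a₂ : B → K := fun s => algebraMap _ K (a₁ s)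
  let b₂ : B → MonoidAlgebra K P.T := fun s =>
    MonoidAlgebra.mapRingHom P.T (algebraMap (Polynomial R) K) (b₁ s)
  have hab₁ : P.IsParameter a₁ b₁ := hab.map Polynomial.C fun s t h => by simp only [a₁, h]
  have hab₂ : P.IsParameter a₂ b₂ := hab₁.map _ fun s t h => by simp only [a₂, h]
  -- `X + a_s` is monic, hence a nonzerodivisor for every `R` and `a_s`, and becomes invertible in
  -- the total ring of fractions `K`.
  have ha₂ : ∀ s, IsUnit (a₂ s) := fun s =>
    IsLocalization.map_units K ⟨a₁ s, (Polynomial.monic_X_add_C (a s)).mem_nonZeroDivisors⟩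
  obtain ⟨φ, hφ⟩ := hab₂.exists_braidHom ha₂
  obtain ⟨θ, hθ⟩ := P.exists_isBernsteinMap
  choose γ hγ _ using fun o : E.Orientation => E.existsUnique_isNegWallProduct o
  obtain ⟨g₁, hg₁⟩ := IsIntegralBernsteinFamily.comap (algebraMap (Polynomial R) K)
    (IsFractionRing.injective _ _) (a := a₁) (b := b₁) (fun _ => rfl) (fun _ => rfl) hab₂
    (hab₂.isIntegralBernsteinFamily_of_braidHom hφ hθ hγ)
  -- Setting `X = 0` sends `X + a_s` back to `a_s` and the constant `b_s` to itself.
  refine hg₁.map (Polynomial.evalRingHom 0) (fun s => by simp [a₁]) fun s => ?_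
  simp only [b₁]
  rw [← RingHom.comp_apply, ← MonoidAlgebra.mapRingHom_comp]
  have : (Polynomial.evalRingHom 0).comp Polynomial.C = RingHom.id R := by ext; simp
  rw [this]
  simp

end ProPCoxeterGroup

end ProPHecke

theorem mainTheorem9 {B W W1 R : Type*} [Group W] [Group W1] [CommRing R]
    (E : ProPHecke.ExtendedCoxeterGroup B W) (P : ProPHecke.ProPCoxeterGroup E W1)
    (a : B → R) (b : B → MonoidAlgebra R P.T) (hab : P.IsParameter a b) :
    -- the elements `T_w` form an `R`-basis of the Hecke algebra
    (LinearIndependent R (P.heckeT a b) ∧ Submodule.span R (Set.range (P.heckeT a b)) = ⊤) ∧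
    -- existence and uniqueness of the integral Bernstein maps
    (∀ o : E.Orientation, ∃! f : W1 → P.HeckeAlgebra a b, P.IsIntegralBernstein a b o f) ∧
    -- existence and uniqueness of `γ` and of the unnormalized Bernstein map `θ`
    (∀ o : E.Orientation, ∃! g : W → E.WallMonoid, E.IsNegWallProduct o g) ∧
    (∃! θ : E.Orientation → W1 → P.BraidGroup, P.IsBernsteinMap θ) ∧
    ∀ θhat : E.Orientation → W1 → P.HeckeAlgebra a b,
      (∀ o, P.IsIntegralBernstein a b o (θhat o)) →
      -- the comparison with the unnormalized Bernstein map for invertible parameters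
      ((∀ s, IsUnit (a s)) →
        ∃ φ : P.BraidGroup →* P.HeckeAlgebra a b, (∀ w, φ (P.braidT w) = P.heckeT a b w) ∧
          ∀ γ : E.Orientation → W → E.WallMonoid, (∀ o, E.IsNegWallProduct o (γ o)) →
          ∀ θ : E.Orientation → W1 → P.BraidGroup, P.IsBernsteinMap θ →
          ∀ (o : E.Orientation) (w : W1),
            θhat o w = E.specialize a (γ o (P.π w)) • φ (θ o w)) ∧
      -- the product rule
      (∀ (o : E.Orientation) (w w' : W1),
        θhat o w * θhat (o.act (P.π w)) w' =
          E.specialize a (E.X (P.π w) (P.π w')) • θhat o (w * w')) := by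
  obtain ⟨g, hg⟩ := hab.exists_isIntegralBernsteinFamily
  obtain ⟨θ, hθ⟩ := P.exists_isBernsteinMap
  refine ⟨⟨hab.linearIndependent_heckeT, P.span_heckeT a b⟩,
    fun o => ⟨g o, hg.isIntegralBernstein o, fun f hf => hf.unique (hg.isIntegralBernstein o)⟩,
    E.existsUnique_isNegWallProduct, ⟨θ, hθ, fun θ' h => h.unique hθ⟩, fun θhat hhat => ⟨?_, ?_⟩⟩
  · intro ha
    obtain ⟨φ, hφ⟩ := hab.exists_braidHom ha
    refine ⟨φ, hφ, fun γ hγ θ hθ o w => ?_⟩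
    have h := hab.isIntegralBernsteinFamily_of_braidHom hφ hθ hγ
    exact congrFun ((hhat o).unique (h.isIntegralBernstein o)) w
  · have h : θhat = g := funext fun o => (hhat o).unique (hg.isIntegralBernstein o)
    rw [h]
    exact hg.mul
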